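/- Let $n>2$ and let $P\subset\mathbb{R}^d$ be a convex polytope (the convex hull of a finite nonempty set of points) of dimension $n$, i.e. whose affine span has dimension $n$. Call a set $X\subset\mathbb{R}^d$ centrally symmetric if there is a point $c\in\mathbb{R}^d$ with $X=\{2c-x : x\in X\}$. If every facet of $P$ (that is, every $(n-1)$-dimensional face of $P$) is centrally symmetric, then $P$ is centrally symmetric. -/

import Mathlib

/-- The symmetric image (point reflection) `2c - X` of a set `X` with respect to the point `c`. -/
def symmetricImage {d : ℕ} (c : EuclideanSpace ℝ (Fin d)) (X : Set (EuclideanSpace ℝ (Fin d))) :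
    Set (EuclideanSpace ℝ (Fin d)) :=
  {y | ∃ x ∈ X, y = (2 : ℝ) • c - x}

/-- A set is centrally symmetric if it equals its symmetric image with respect to some point. -/
def IsCentrallySymmetric {d : ℕ} (X : Set (EuclideanSpace ℝ (Fin d))) : Prop :=
  ∃ c : EuclideanSpace ℝ (Fin d), X = symmetricImage c X

/-- A convex polytope: the convex hull of a finite nonempty set of points. -/
def IsConvexPolytope {d : ℕ} (P : Set (EuclideanSpace ℝ (Fin d))) : Prop :=
  ∃ V : Set (EuclideanSpace ℝ (Fin d)), V.Finite ∧ V.Nonempty ∧ P = convexHull ℝ V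

/-- The dimension of a nonempty set: the dimension of its affine span. -/
noncomputable def affineDim {d : ℕ} (X : Set (EuclideanSpace ℝ (Fin d))) : ℕ :=
  Module.finrank ℝ (vectorSpan ℝ X)

/-- A facet of a polytope `P`: a nonempty face of `P` (the set of points of `P` at which some linear
functional attains its maximum over `P`) whose dimension is one less than that of `P`. -/
def IsFacet {d : ℕ} (P F : Set (EuclideanSpace ℝ (Fin d))) : Prop :=
  F.Nonempty ∧ IsExposed ℝ P F ∧ affineDim F + 1 = affineDim P

open MeasureTheory Set
open scoped ENNReal Pointwise Topology

/-! Inside its affine hull `P` is full-dimensional. Write P^f for the face where the functional f is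
maximal. Let P^u be a facet and R = (P^u)^v a facet of it. Rotate v + s u from the direction of u (s
near +∞) to that of -u (s near -∞). If u is not constant on a face met on the way, that face turns
out to be a facet, and its central symmetry exchanges the end where u is maximal with the end where
u is minimal. So every end met is R up to translation and reflection, and the last one is (P^{-u})^v
(`IsPolytope.isSignedTranslate_maxFace_neg`). Hence P^{-u} is again a facet, and the facets of P^u
and P^{-u} correspond up to translation and reflection.

Minkowski's uniqueness theorem (`exists_translate_of_isSignedTranslate`) says that polytopes of full
dimension at least 2 whose facets correspond in this way are translates. It is used twice: for P^u
and P^{-u} inside ker u, of dimension n - 1 ≥ 2, which is where n > 2 enters; then for P and -P,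
whose faces in direction u are P^u and -P^{-u}. The result P = z - P is central symmetry.

For the uniqueness theorem, cut A into cones over its facets, with apex 0 in the interior. The
volume of B is then the sum over facet normals v of A of vol(cone over A^v) times max_B v.
Brunn–Minkowski, differentiated at A, bounds vol A by such sums; after scaling this gives vol A =
vol B and vol((A + B)/2) = vol A, which is equality in Brunn–Minkowski. The equality case
(`Convex.exists_translate_of_measure_midpoint_eq`) compares the distribution functions of each
linear functional on the two bodies. -/

/-! ### Prékopa–Leindler and Brunn–Minkowski inequalities for midpoints -/

theorem volume_add_le_two_mul_of_midpoint_isCompact {S T U : Set ℝ} (hS : IsCompact S)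
    (hT : IsCompact T) (hSn : S.Nonempty) (hTn : T.Nonempty)
    (h : ∀ x ∈ S, ∀ y ∈ T, (x + y) / 2 ∈ U) : volume S + volume T ≤ 2 * volume U := by
  obtain ⟨a, haS, ha⟩ := hS.exists_isGreatest hSn
  obtain ⟨b, hbT, hb⟩ := hT.exists_isLeast hTn
  -- With a = max S and b = min T, the translates S + b and a + T both lie in 2U and meet only at a
  -- + b.
  have hsub : ((fun x => x + b) '' S) ∪ ((fun y => a + y) '' T) ⊆ (2 : ℝ) • U := by
    rintro _ (⟨x, hx, rfl⟩ | ⟨y, hy, rfl⟩)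
    · exact ⟨(x + b) / 2, h x hx b hbT, by simp only [smul_eq_mul]; ring⟩
    · exact ⟨(a + y) / 2, h a haS y hy, by simp only [smul_eq_mul]; ring⟩
  have hint : ((fun x => x + b) '' S) ∩ ((fun y => a + y) '' T) ⊆ {a + b} := by
    rintro _ ⟨⟨x, hx, rfl⟩, ⟨y, hy, hxy⟩⟩
    have h1 := ha hx
    have h2 := hb hy
    simp only [mem_singleton_iff] at *
    linarith
  have hTm : MeasurableSet ((fun y => a + y) '' T) :=
    (hT.image (continuous_const.add continuous_id)).measurableSet
  have hdisj : AEDisjoint volume ((fun x => x + b) '' S) ((fun y => a + y) '' T) :=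
    measure_mono_null hint (by simp)
  calc volume S + volume T
      = volume ((fun x => x + b) '' S) + volume ((fun y => a + y) '' T) := by
        rw [image_add_right, image_add_left, measure_preimage_add_right, measure_preimage_add]
    _ = volume (((fun x => x + b) '' S) ∪ ((fun y => a + y) '' T)) :=
        (measure_union₀ hTm.nullMeasurableSet hdisj).symm
    _ ≤ volume ((2 : ℝ) • U) := measure_mono hsub
    _ = 2 * volume U := by rw [Measure.addHaar_smul]; simp

theorem volume_add_le_two_mul_of_midpoint {S T U : Set ℝ} (hS : MeasurableSet S)
    (hT : MeasurableSet T) (hSn : S.Nonempty) (hTn : T.Nonempty)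
    (h : ∀ x ∈ S, ∀ y ∈ T, (x + y) / 2 ∈ U) : volume S + volume T ≤ 2 * volume U := by
  obtain ⟨s₀, hs₀⟩ := hSn
  obtain ⟨t₀, ht₀⟩ := hTn
  have key : ∀ K, K ⊆ S → IsCompact K → ∀ L, L ⊆ T → IsCompact L →
      volume K + volume L ≤ 2 * volume U := by
    intro K hK hKc L hL hLc
    -- Inner regularity may produce empty compact sets; adding one point of `S` and of `T` makes the
    -- compact case applicable.
    refine le_trans (add_le_add (measure_mono (subset_insert s₀ K))
      (measure_mono (subset_insert t₀ L))) ?_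
    exact volume_add_le_two_mul_of_midpoint_isCompact (hKc.insert s₀) (hLc.insert t₀)
      (insert_nonempty _ _) (insert_nonempty _ _)
      fun x hx y hy => h x (insert_subset hs₀ hK hx) y (insert_subset ht₀ hL hy)
  rw [hS.measure_eq_iSup_isCompact, hT.measure_eq_iSup_isCompact]
  simp only [iSup_and']
  exact ENNReal.biSup_add_biSup_le' ⟨∅, empty_subset _, isCompact_empty⟩
    ⟨∅, empty_subset _, isCompact_empty⟩ fun K hK L hL => key K hK.1 hK.2 L hL.1 hL.2

/-- Layer cake: integrate the one-dimensional inequality over superlevel sets. That inequality needs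
both sets nonempty, so `f` and `g` must exceed exactly the same levels, those below 1. -/
theorem lintegral_add_le_two_mul_of_levels {f g h : ℝ → ℝ} (hf : Measurable f) (hg : Measurable g)
    (hh : Measurable h) (hf0 : ∀ x, 0 ≤ f x) (hg0 : ∀ x, 0 ≤ g x) (hh0 : ∀ x, 0 ≤ h x)
    (hf1 : ∀ x, f x ≤ 1) (hg1 : ∀ x, g x ≤ 1) (hfs : ∀ t, 0 < t → t < 1 → ∃ x, t < f x)
    (hgs : ∀ t, 0 < t → t < 1 → ∃ x, t < g x)
    (hfg : ∀ t, 0 ≤ t → ∀ x y, t < f x → t < g y → t < h ((x + y) / 2)) :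
    (∫⁻ x, ENNReal.ofReal (f x)) + (∫⁻ x, ENNReal.ofReal (g x)) ≤ 2 * ∫⁻ x, ENNReal.ofReal (h x) := by
  rw [lintegral_eq_lintegral_meas_lt _ (.of_forall hf0) hf.aemeasurable,
    lintegral_eq_lintegral_meas_lt _ (.of_forall hg0) hg.aemeasurable,
    lintegral_eq_lintegral_meas_lt _ (.of_forall hh0) hh.aemeasurable,
    ← lintegral_const_mul' _ _ (by simp), ← lintegral_add_left']
  · refine setLIntegral_mono' measurableSet_Ioi fun t ht => ?_
    rcases lt_or_ge t 1 with h1 | h1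
    · exact volume_add_le_two_mul_of_midpoint (measurableSet_lt measurable_const hf)
        (measurableSet_lt measurable_const hg) (hfs t ht h1) (hgs t ht h1)
        fun x hx y hy => hfg t (le_of_lt ht) x y hx hy
    · have e1 : {a | t < f a} = ∅ := by ext x; simpa using (hf1 x).trans h1
      have e2 : {a | t < g a} = ∅ := by ext x; simpa using (hg1 x).trans h1
      simp [e1, e2]
  · refine (Antitone.measurable ?_).aemeasurable
    exact fun s t hst => measure_mono fun x hx => lt_of_le_of_lt hst hx

theorem ENNReal.four_mul_le_add_sq (a b : ℝ≥0∞) : 4 * (a * b) ≤ (a + b) ^ 2 := by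
  by_cases ha : a = ∞
  · simp [ha]
  by_cases hb : b = ∞
  · simp [hb]
  lift a to NNReal using ha
  lift b to NNReal using hb
  norm_cast
  rw [← NNReal.coe_le_coe]
  push_cast
  nlinarith [sq_nonneg ((a : ℝ) - b)]

/-- Dividing `f` and `g` by their suprema a and b, and `h` by √(ab), keeps the hypothesis and gives
`f` and `g` a common supremum 1. The additive level-set inequality then yields the multiplicative
one by AM-GM. -/
theorem lintegral_mul_lintegral_le_sq_of_bounded {f g h : ℝ → ℝ≥0∞} (hf : Measurable f)
    (hg : Measurable g) (hh : Measurable h) (hfb : ⨆ x, f x ≠ ∞) (hgb : ⨆ x, g x ≠ ∞)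
    (hfg : ∀ x y, f x * g y ≤ h ((x + y) / 2) ^ 2) :
    (∫⁻ x, f x) * (∫⁻ x, g x) ≤ (∫⁻ x, h x) ^ 2 := by
  by_cases hf0 : (⨆ x, f x) = 0
  · have : ∀ x, f x = 0 := by simpa using hf0
    simp [this]
  by_cases hg0 : (⨆ x, g x) = 0
  · have : ∀ x, g x = 0 := by simpa using hg0
    simp [this]
  set a := (⨆ x, f x).toReal with ha
  set b := (⨆ x, g x).toReal with hb
  have ha0 : 0 < a := ENNReal.toReal_pos hf0 hfb
  have hb0 : 0 < b := ENNReal.toReal_pos hg0 hgb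
  have hfx : ∀ x, f x ≠ ∞ := fun x => ne_top_of_le_ne_top hfb (le_iSup f x)
  have hgx : ∀ x, g x ≠ ∞ := fun x => ne_top_of_le_ne_top hgb (le_iSup g x)
  set c := Real.sqrt (a * b) with hc
  have hc0 : 0 < c := Real.sqrt_pos.2 (mul_pos ha0 hb0)
  have hcc : c * c = a * b := Real.mul_self_sqrt (mul_pos ha0 hb0).le
  let f' : ℝ → ℝ := fun x => (f x).toReal / a
  let g' : ℝ → ℝ := fun x => (g x).toReal / b
  -- `h` may be infinite; cutting it at 1 makes it real-valued and loses nothing, as only levels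
  -- below 1 matter.
  let h' : ℝ → ℝ := fun x => (min (h x / ENNReal.ofReal c) 1).toReal
  have hh'top : ∀ x, min (h x / ENNReal.ofReal c) 1 ≠ ∞ := fun x =>
    ne_top_of_le_ne_top ENNReal.one_ne_top (min_le_right _ _)
  have hf1 : ∀ x, f' x ≤ 1 := fun x => by
    rw [div_le_one ha0]
    exact ENNReal.toReal_mono hfb (le_iSup f x)
  have hg1 : ∀ x, g' x ≤ 1 := fun x => by
    rw [div_le_one hb0]
    exact ENNReal.toReal_mono hgb (le_iSup g x)
  have hsup : ∀ (k : ℝ → ℝ≥0∞), (⨆ x, k x) ≠ ∞ → 0 < (⨆ x, k x).toReal → (∀ x, k x ≠ ∞) →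
      ∀ t, 0 < t → t < 1 → ∃ x, t < (k x).toReal / (⨆ x, k x).toReal := by
    intro k hk hk0 hkx t ht0 ht
    have hlt : ENNReal.ofReal (t * (⨆ x, k x).toReal) < ⨆ x, k x := by
      rw [ENNReal.ofReal_lt_iff_lt_toReal (by positivity) hk]
      nlinarith
    obtain ⟨x, hx⟩ := lt_iSup_iff.1 hlt
    refine ⟨x, ?_⟩
    rw [lt_div_iff₀ hk0]
    exact (ENNReal.ofReal_lt_iff_lt_toReal (by positivity) (hkx x)).1 hx
  have key := lintegral_add_le_two_mul_of_levels (f := f') (g := g') (h := h')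
    (hf.ennreal_toReal.div_const a) (hg.ennreal_toReal.div_const b)
    ((hh.div_const _).min measurable_const).ennreal_toReal (fun x => by positivity)
    (fun x => by positivity) (fun x => ENNReal.toReal_nonneg) hf1 hg1
    (hsup f hfb ha0 hfx) (hsup g hgb hb0 hgx) ?_
  · have hfi : ∫⁻ x, f x = ENNReal.ofReal a * ∫⁻ x, ENNReal.ofReal (f' x) := by
      rw [← lintegral_const_mul' _ _ ENNReal.ofReal_ne_top]
      refine lintegral_congr fun x => ?_
      rw [← ENNReal.ofReal_mul ha0.le, mul_div_cancel₀ _ ha0.ne', ENNReal.ofReal_toReal (hfx x)]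
    have hgi : ∫⁻ x, g x = ENNReal.ofReal b * ∫⁻ x, ENNReal.ofReal (g' x) := by
      rw [← lintegral_const_mul' _ _ ENNReal.ofReal_ne_top]
      refine lintegral_congr fun x => ?_
      rw [← ENNReal.ofReal_mul hb0.le, mul_div_cancel₀ _ hb0.ne', ENNReal.ofReal_toReal (hgx x)]
    have hhi : ENNReal.ofReal c * ∫⁻ x, ENNReal.ofReal (h' x) ≤ ∫⁻ x, h x := by
      rw [← lintegral_const_mul' _ _ ENNReal.ofReal_ne_top]
      refine lintegral_mono fun x => ?_
      simp only [h']
      rw [ENNReal.ofReal_toReal (hh'top x)]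
      refine (mul_le_mul_right (min_le_left _ _) _).trans ?_
      exact ENNReal.mul_div_le
    have h4 : (∫⁻ x, ENNReal.ofReal (f' x)) * (∫⁻ x, ENNReal.ofReal (g' x)) ≤
        (∫⁻ x, ENNReal.ofReal (h' x)) ^ 2 := by
      have h5 := (ENNReal.four_mul_le_add_sq _ _).trans (pow_le_pow_left' key 2)
      rw [mul_pow, show (2 : ℝ≥0∞) ^ 2 = 4 by norm_num] at h5
      exact (ENNReal.mul_le_mul_iff_right (by norm_num) (by norm_num)).1 h5
    calc (∫⁻ x, f x) * (∫⁻ x, g x)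
        = (ENNReal.ofReal a * ENNReal.ofReal b) *
          ((∫⁻ x, ENNReal.ofReal (f' x)) * (∫⁻ x, ENNReal.ofReal (g' x))) := by
          rw [hfi, hgi]; ring
      _ ≤ (ENNReal.ofReal c * ENNReal.ofReal c) * (∫⁻ x, ENNReal.ofReal (h' x)) ^ 2 := by
          rw [← ENNReal.ofReal_mul ha0.le, ← ENNReal.ofReal_mul hc0.le, hcc]
          gcongr
      _ = (ENNReal.ofReal c * ∫⁻ x, ENNReal.ofReal (h' x)) ^ 2 := by ring
      _ ≤ _ := pow_le_pow_left' hhi 2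
  · intro t ht x y htx hty
    simp only [h', f', g'] at htx hty ⊢
    set m := (x + y) / 2
    have ht1 : t < 1 := htx.trans_le (hf1 x)
    rw [← ENNReal.ofReal_lt_iff_lt_toReal ht (hh'top m), lt_min_iff]
    refine ⟨?_, by simpa using ht1⟩
    rw [ENNReal.lt_div_iff_mul_lt (by simp [hc0]) (by simp), ← ENNReal.ofReal_mul ht]
    by_contra! hle
    have h1 : f x * g y ≤ ENNReal.ofReal (t * c) ^ 2 := (hfg x y).trans (pow_le_pow_left' hle 2)
    have h2 := ENNReal.toReal_mono (by simp) h1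
    rw [ENNReal.toReal_mul, ENNReal.toReal_pow, ENNReal.toReal_ofReal (by positivity)] at h2
    rw [lt_div_iff₀ ha0] at htx
    rw [lt_div_iff₀ hb0] at hty
    have h3 : (t * a) * (t * b) < (f x).toReal * (g y).toReal :=
      mul_lt_mul'' htx hty (by positivity) (by positivity)
    have h4 : (t * c) ^ 2 = t * a * (t * b) := by linear_combination t ^ 2 * hcc
    linarith

theorem lintegral_mul_lintegral_le_sq {f g h : ℝ → ℝ≥0∞} (hf : Measurable f)
    (hg : Measurable g) (hh : Measurable h)
    (hfg : ∀ x y, f x * g y ≤ h ((x + y) / 2) ^ 2) :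
    (∫⁻ x, f x) * (∫⁻ x, g x) ≤ (∫⁻ x, h x) ^ 2 := by
  have htrunc : ∀ k : ℝ → ℝ≥0∞, Measurable k →
      ∫⁻ x, k x = ⨆ n : ℕ, ∫⁻ x, min (k x) n := by
    intro k hk
    rw [← lintegral_iSup (fun n => hk.min measurable_const)]
    · refine lintegral_congr fun x => ?_
      rw [← inf_iSup_eq (k x), ENNReal.iSup_natCast, inf_top_eq]
    · exact fun n m hnm x => min_le_min_left _ (by exact_mod_cast hnm)
  rw [htrunc f hf, htrunc g hg, ENNReal.iSup_mul]
  refine iSup_le fun n => ?_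
  rw [ENNReal.mul_iSup]
  refine iSup_le fun m => ?_
  refine lintegral_mul_lintegral_le_sq_of_bounded (hf.min measurable_const)
    (hg.min measurable_const) hh ?_ ?_ fun x y =>
      (mul_le_mul' (min_le_left _ _) (min_le_left _ _)).trans (hfg x y)
  · exact ne_top_of_le_ne_top (ENNReal.natCast_ne_top n) (iSup_le fun x => min_le_right _ _)
  · exact ne_top_of_le_ne_top (ENNReal.natCast_ne_top m) (iSup_le fun x => min_le_right _ _)

/-- Fubini on the first coordinate: the induction hypothesis applied to the slices at s, t and (s +
t)/2 shows that the slice integrals satisfy the one-dimensional hypothesis. -/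
theorem lintegral_pi_mul_lintegral_le_sq (n : ℕ) : ∀ {f g h : (Fin n → ℝ) → ℝ≥0∞},
    Measurable f → Measurable g → Measurable h →
    (∀ x y, f x * g y ≤ h ((2⁻¹ : ℝ) • (x + y)) ^ 2) →
    (∫⁻ x, f x) * (∫⁻ x, g x) ≤ (∫⁻ x, h x) ^ 2 := by
  induction n with
  | zero =>
    intro f g h hf hg hh hfg
    rw [volume_pi, Measure.pi_of_empty _ 0]
    simpa [lintegral_dirac] using hfg 0 0
  | succ n ih =>
    intro f g h hf hg hh hfg
    let e := MeasurableEquiv.piFinSuccAbove (fun _ : Fin (n + 1) => ℝ) 0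
    have he : MeasurePreserving e.symm :=
      (volume_preserving_piFinSuccAbove (fun _ : Fin (n + 1) => ℝ) 0).symm
    have hes : ∀ p : ℝ × (Fin n → ℝ), e.symm p = Fin.cons p.1 p.2 := fun p => by
      simp [e, MeasurableEquiv.piFinSuccAbove, Fin.insertNthEquiv]
    have hint : ∀ k : (Fin (n + 1) → ℝ) → ℝ≥0∞, Measurable k →
        ∫⁻ x, k x = ∫⁻ s, ∫⁻ y, k (e.symm (s, y)) := by
      intro k hk
      rw [← he.lintegral_comp hk, Measure.volume_eq_prod]
      exact lintegral_prod _ (hk.comp e.symm.measurable).aemeasurable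
    have hmeas : ∀ k : (Fin (n + 1) → ℝ) → ℝ≥0∞, Measurable k →
        Measurable fun s => ∫⁻ y, k (e.symm (s, y)) := fun k hk =>
      (hk.comp e.symm.measurable).lintegral_prod_right'
    rw [hint f hf, hint g hg, hint h hh]
    refine lintegral_mul_lintegral_le_sq (hmeas f hf) (hmeas g hg) (hmeas h hh) fun s t => ?_
    have hm : ∀ (k : (Fin (n + 1) → ℝ) → ℝ≥0∞) (_ : Measurable k) (s : ℝ),
        Measurable fun y => k (e.symm (s, y)) := fun k hk s =>
      (hk.comp e.symm.measurable).comp measurable_prodMk_left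
    refine ih (hm f hf s) (hm g hg t) (hm h hh _) fun x y => ?_
    convert hfg (e.symm (s, x)) (e.symm (t, y)) using 3
    rw [hes, hes, hes]
    ext i
    refine Fin.cases ?_ (fun j => ?_) i
    · simp; ring
    · simp; ring

theorem volume_pi_mul_volume_le_sq {n : ℕ} {K L U : Set (Fin n → ℝ)} (hK : MeasurableSet K)
    (hL : MeasurableSet L) (hU : MeasurableSet U)
    (h : ∀ x ∈ K, ∀ y ∈ L, (2⁻¹ : ℝ) • (x + y) ∈ U) :
    volume K * volume L ≤ volume U ^ 2 := by
  have := lintegral_pi_mul_lintegral_le_sq n (f := K.indicator 1) (g := L.indicator 1)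
    (h := U.indicator 1) (measurable_one.indicator hK) (measurable_one.indicator hL)
    (measurable_one.indicator hU) fun x y => by
      by_cases hx : x ∈ K <;> by_cases hy : y ∈ L
      · have hm := h x hx y hy
        simp only [indicator_of_mem hx, indicator_of_mem hy, indicator_of_mem hm]
        simp
      all_goals simp [hx, hy]
  simpa [lintegral_indicator_one, hK, hL, hU] using this

/-- The multiplicative Brunn–Minkowski inequality for midpoints. -/
theorem measure_mul_measure_le_sq_of_midpoint {E : Type*} [NormedAddCommGroup E] [NormedSpace ℝ E]
    [FiniteDimensional ℝ E] [MeasurableSpace E] [BorelSpace E] (μ : Measure E)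
    [μ.IsAddHaarMeasure] {K L U : Set E} (hK : MeasurableSet K)
    (hL : MeasurableSet L) (hU : MeasurableSet U)
    (h : ∀ x ∈ K, ∀ y ∈ L, (2⁻¹ : ℝ) • (x + y) ∈ U) :
    μ K * μ L ≤ μ U ^ 2 := by
  let e : E ≃L[ℝ] (Fin (Module.finrank ℝ E) → ℝ) :=
    ContinuousLinearEquiv.ofFinrankEq (by simp)
  have : (μ.map e).IsAddHaarMeasure := e.isAddHaarMeasure_map μ
  have hmap : μ.map e = Measure.addHaarScalarFactor (μ.map e) volume • volume :=
    Measure.isAddLeftInvariant_eq_smul _ _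
  set c := Measure.addHaarScalarFactor (μ.map e) volume
  have hem : ∀ S : Set E, μ S = c * volume (e.symm ⁻¹' S) := fun S => by
    have h1 : μ S = (μ.map e) (e.symm ⁻¹' S) := by
      rw [← e.coe_toHomeomorph, ← Homeomorph.toMeasurableEquiv_coe, MeasurableEquiv.map_apply]
      congr 1
      ext x
      simp
    rw [h1, hmap]
    rfl
  rw [hem K, hem L, hem U]
  have hsm : Measurable e.symm := e.symm.continuous.measurable
  have := volume_pi_mul_volume_le_sq (hsm hK) (hsm hL) (hsm hU)
    fun x hx y hy => by simpa using h _ hx _ hy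
  calc _ = (c : ℝ≥0∞) * c * (volume (e.symm ⁻¹' K) * volume (e.symm ⁻¹' L)) := by ring
    _ ≤ (c : ℝ≥0∞) * c * volume (e.symm ⁻¹' U) ^ 2 := by gcongr
    _ = _ := by ring

/-! ### Distribution functions forced to be shifts of one another -/

/-- A continuous distribution function of total mass `a` that is strictly increasing on the
preimage of `(0, a)`. -/
structure IsStrictDistribution (a : ℝ) (α : ℝ → ℝ) : Prop where
  continuous : Continuous α
  mono : Monotone α
  nonneg : ∀ x, 0 ≤ α x
  le : ∀ x, α x ≤ a
  exists_zero : ∃ x, α x = 0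
  exists_top : ∃ x, α x = a
  strict : ∀ x y, x < y → α x = α y → α x = 0 ∨ α x = a

namespace IsStrictDistribution

variable {a : ℝ} {α β γ : ℝ → ℝ}

theorem exists_eq (h : IsStrictDistribution a α) {θ : ℝ} (h0 : 0 ≤ θ) (h1 : θ ≤ a) :
    ∃ s, α s = θ := by
  obtain ⟨x, hx⟩ := h.exists_zero
  obtain ⟨y, hy⟩ := h.exists_top
  exact mem_range_of_exists_le_of_exists_ge h.continuous ⟨x, hx.trans_le h0⟩ ⟨y, h1.trans_eq hy.symm⟩

theorem le_of_le (h : IsStrictDistribution a α) {x y : ℝ} (h0 : 0 < α x) (h1 : α x < a)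
    (hxy : α x ≤ α y) : x ≤ y := by
  by_contra! hlt
  have he : α y = α x := le_antisymm (h.mono hlt.le) hxy
  rcases h.strict y x hlt he with h2 | h2 <;> linarith

theorem lt_of_lt (h : IsStrictDistribution a α) {x y : ℝ} (hxy : α x < α y) : x < y := by
  by_contra! hlt
  exact absurd (h.mono hlt) (not_le.2 hxy)

/-- When both arguments sit at level η, the two inequalities squeeze γ((s' + t')/2) to exactly η. At
(s, t) the geometric mean of the levels is η, so γ((s + t)/2) ≥ η, and strict increase of γ compares
the midpoints. -/
theorem add_le_add_of_sqrt (hγ : IsStrictDistribution a γ)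
    (h1 : ∀ s t, α s * β t ≤ γ ((s + t) / 2) ^ 2)
    (h2 : ∀ s t, (a - α s) * (a - β t) ≤ (a - γ ((s + t) / 2)) ^ 2)
    {s t s' t' η : ℝ} (hη0 : 0 < η) (hηa : η < a) (hst : α s * β t = η ^ 2)
    (hs' : α s' = η) (ht' : β t' = η) : s' + t' ≤ s + t := by
  have e1 : η ≤ γ ((s' + t') / 2) := by
    have := h1 s' t'
    rw [hs', ht'] at this
    exact (pow_le_pow_iff_left₀ hη0.le (hγ.nonneg _) two_ne_zero).1 (by nlinarith)
  have e2 : γ ((s' + t') / 2) ≤ η := by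
    have := h2 s' t'
    rw [hs', ht'] at this
    have := (pow_le_pow_iff_left₀ (a := a - η) (b := a - γ ((s' + t') / 2)) (by linarith)
      (by linarith [hγ.le ((s' + t') / 2)]) two_ne_zero).1 (by nlinarith)
    linarith
  have e3 : η ≤ γ ((s + t) / 2) := by
    have := h1 s t
    rw [hst] at this
    exact (pow_le_pow_iff_left₀ hη0.le (hγ.nonneg _) two_ne_zero).1 this
  have := hγ.le_of_le (x := (s' + t') / 2) (y := (s + t) / 2) (by linarith) (by linarith)
    (by linarith)
  linarith

/-- Interpolate from θ₁ to θ₂ by a geometric progression of ratio ρ. At consecutive levels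
`add_le_add_of_sqrt` bounds an increment of p by the next increment of q. Telescoping gives p θ₂ - p
θ₁ ≤ q(θ₂ρ) - q(θ₁ρ), and ρ is taken close to 1. -/
theorem quantile_sub_le (hβ : IsStrictDistribution a β)
    (hγ : IsStrictDistribution a γ)
    (h1 : ∀ s t, α s * β t ≤ γ ((s + t) / 2) ^ 2)
    (h2 : ∀ s t, (a - α s) * (a - β t) ≤ (a - γ ((s + t) / 2)) ^ 2)
    {p q : ℝ → ℝ} (hp : ∀ θ, 0 < θ → θ < a → α (p θ) = θ)
    (hq : ∀ θ, 0 < θ → θ < a → β (q θ) = θ) {θ₁ θ₂ : ℝ} (h01 : 0 < θ₁) (h12 : θ₁ ≤ θ₂)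
    (h2a : θ₂ < a) : p θ₂ - p θ₁ ≤ q θ₂ - q θ₁ := by
  have h02 : 0 < θ₂ := h01.trans_le h12
  refine le_of_forall_pos_le_add fun ε hε => ?_
  -- Strictness of β leaves room for the overshoot: once θ₂ρ is below this value, q(θ₂ρ) ≤ q θ₂ + ε.
  have hlt : θ₂ < β (q θ₂ + ε) := by
    have hle : θ₂ ≤ β (q θ₂ + ε) := by
      conv_lhs => rw [← hq θ₂ h02 h2a]
      exact hβ.mono (by linarith)
    refine lt_of_le_of_ne hle fun he => ?_
    rcases hβ.strict (q θ₂) (q θ₂ + ε) (by linarith) (by rw [hq θ₂ h02 h2a, ← he]) with h | h <;>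
      rw [hq θ₂ h02 h2a] at h <;> linarith
  have htend : Filter.Tendsto (fun n : ℕ => θ₂ * (θ₂ / θ₁) ^ ((1 : ℝ) / (n + 1 : ℝ)))
      Filter.atTop (nhds (θ₂ * 1)) := by
    refine Filter.Tendsto.const_mul _ ?_
    have := (Real.continuousAt_const_rpow (a := θ₂ / θ₁) (b := 0) (by positivity)).tendsto.comp
      (tendsto_one_div_add_atTop_nhds_zero_nat (𝕜 := ℝ))
    rw [Real.rpow_zero] at this
    exact this
  rw [mul_one] at htend
  obtain ⟨n, hn1, hn2⟩ := ((htend.eventually_lt_const hlt).and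
    (htend.eventually_lt_const h2a)).exists
  set ρ := (θ₂ / θ₁) ^ ((1 : ℝ) / (n + 1 : ℝ)) with hρ
  have hρ1 : 1 ≤ ρ := Real.one_le_rpow (by rwa [one_le_div h01]) (by positivity)
  have hρn : θ₁ * ρ ^ (n + 1) = θ₂ := by
    rw [hρ, ← Real.rpow_natCast, ← Real.rpow_mul (by positivity)]
    push_cast
    rw [one_div_mul_cancel (by positivity), Real.rpow_one]
    field_simp
  have hlt_a : ∀ i ≤ n + 1, θ₁ * ρ ^ (i + 1) < a := fun i hi => by
    refine lt_of_le_of_lt ?_ hn2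
    rw [← hρn, mul_assoc, ← pow_succ]
    exact mul_le_mul_of_nonneg_left (pow_le_pow_right₀ hρ1 (by omega)) h01.le
  have hpos : ∀ i : ℕ, 0 < θ₁ * ρ ^ i := fun i => by positivity
  have step : ∀ i ≤ n, p (θ₁ * ρ ^ (i + 1)) - p (θ₁ * ρ ^ i) ≤
      q (θ₁ * ρ ^ (i + 2)) - q (θ₁ * ρ ^ (i + 1)) := fun i hi => by
    have hi0 : θ₁ * ρ ^ i < a := by
      refine lt_of_le_of_lt ?_ (hlt_a i (by omega))
      exact mul_le_mul_of_nonneg_left (pow_le_pow_right₀ hρ1 (by omega)) h01.le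
    have hi1 := hlt_a i (by omega)
    have hi2 := hlt_a (i + 1) (by omega)
    have := hγ.add_le_add_of_sqrt h1 h2 (s := p (θ₁ * ρ ^ i)) (t := q (θ₁ * ρ ^ (i + 2)))
      (s' := p (θ₁ * ρ ^ (i + 1))) (t' := q (θ₁ * ρ ^ (i + 1))) (hpos (i + 1)) hi1
      (by rw [hp _ (hpos i) hi0, hq _ (hpos _) hi2]; ring) (hp _ (hpos _) hi1) (hq _ (hpos _) hi1)
    linarith
  have sum : ∀ i ≤ n + 1, p (θ₁ * ρ ^ i) - p θ₁ ≤ q (θ₁ * ρ ^ (i + 1)) - q (θ₁ * ρ) := by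
    intro i
    induction i with
    | zero => intro _; simp
    | succ i ih =>
      intro hi
      have := ih (by omega)
      have := step i (by omega)
      linarith
  have hfin := sum (n + 1) le_rfl
  rw [hρn, pow_succ, ← mul_assoc, hρn] at hfin
  have hq1 : q (θ₂ * ρ) ≤ q θ₂ + ε := by
    by_contra! hgt
    have := hβ.mono hgt.le
    rw [hq _ (by positivity) hn2] at this
    linarith
  have hq2 : q θ₁ ≤ q (θ₁ * ρ) := by
    have hle : θ₁ ≤ θ₁ * ρ := le_mul_of_one_le_right h01.le hρ1
    have hla : θ₁ * ρ < a := by simpa using hlt_a 0 (by omega)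
    refine hβ.le_of_le ?_ ?_ ?_
    · rwa [hq _ h01 (by linarith)]
    · rw [hq _ h01 (by linarith)]; linarith
    · rwa [hq _ h01 (by linarith), hq _ (by positivity) hla]
  linarith

theorem le_shift (hα : IsStrictDistribution a α) (hβ : IsStrictDistribution a β)
    {p q : ℝ → ℝ} (hp : ∀ θ, 0 < θ → θ < a → α (p θ) = θ)
    (hq : ∀ θ, 0 < θ → θ < a → β (q θ) = θ) {κ : ℝ}
    (hκ : ∀ θ, 0 < θ → θ < a → p θ - q θ = κ) (s : ℝ) : α s ≤ β (s - κ) := by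
  by_contra! hlt
  obtain ⟨θ, h1, h2⟩ := exists_between hlt
  have h0 : 0 < θ := (hβ.nonneg _).trans_lt h1
  have ha : θ < a := h2.trans_le (hα.le s)
  have e1 : p θ < s := hα.lt_of_lt (by rwa [hp θ h0 ha])
  have e2 : q θ ≤ s - κ := by linarith [hκ θ h0 ha]
  have := hβ.mono e2
  rw [hq θ h0 ha] at this
  linarith

/-- The hypotheses are symmetric in α and β, so the increments of the two quantile functions agree
and their difference is a constant κ, read off at a/2. -/
theorem exists_shift (hα : IsStrictDistribution a α) (hβ : IsStrictDistribution a β)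
    (hγ : IsStrictDistribution a γ)
    (h1 : ∀ s t, α s * β t ≤ γ ((s + t) / 2) ^ 2)
    (h2 : ∀ s t, (a - α s) * (a - β t) ≤ (a - γ ((s + t) / 2)) ^ 2) :
    ∃ κ, ∀ s, α s = β (s - κ) := by
  have hp : ∀ θ, ∃ s, 0 < θ → θ < a → α s = θ := fun θ => by
    by_cases h : 0 < θ ∧ θ < a
    · obtain ⟨s, hs⟩ := hα.exists_eq h.1.le h.2.le
      exact ⟨s, fun _ _ => hs⟩
    · exact ⟨0, fun h0 h1 => absurd ⟨h0, h1⟩ h⟩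
  have hq : ∀ θ, ∃ s, 0 < θ → θ < a → β s = θ := fun θ => by
    by_cases h : 0 < θ ∧ θ < a
    · obtain ⟨s, hs⟩ := hβ.exists_eq h.1.le h.2.le
      exact ⟨s, fun _ _ => hs⟩
    · exact ⟨0, fun h0 h1 => absurd ⟨h0, h1⟩ h⟩
  choose p hp using hp
  choose q hq using hq
  have hc : ∀ θ₁ θ₂, 0 < θ₁ → θ₁ ≤ θ₂ → θ₂ < a → p θ₂ - p θ₁ = q θ₂ - q θ₁ :=
    fun θ₁ θ₂ h01 h12 h2a => le_antisymm (quantile_sub_le hβ hγ h1 h2 hp hq h01 h12 h2a)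
      (quantile_sub_le hα hγ (fun s t => by rw [mul_comm, add_comm]; exact h1 t s)
        (fun s t => by rw [mul_comm, add_comm]; exact h2 t s) hq hp h01 h12 h2a)
  have hκ : ∀ θ, 0 < θ → θ < a → p θ - q θ = p (a / 2) - q (a / 2) := fun θ h0 hθa => by
    rcases le_total θ (a / 2) with h | h
    · have := hc _ _ h0 h (by linarith)
      linarith
    · have := hc _ _ (by linarith) h hθa
      linarith
  refine ⟨p (a / 2) - q (a / 2), fun s => le_antisymm (le_shift hα hβ hp hq hκ s) ?_⟩
  have := le_shift hβ hα hq hp (κ := -(p (a / 2) - q (a / 2)))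
    (fun θ h0 h1 => by linarith [hκ θ h0 h1]) (s - (p (a / 2) - q (a / 2)))
  rwa [sub_neg_eq_add, sub_add_cancel] at this

end IsStrictDistribution

/-! ### Equality case of Brunn–Minkowski -/

section Body

variable {E : Type*} [NormedAddCommGroup E] [NormedSpace ℝ E] [FiniteDimensional ℝ E]
  [MeasurableSpace E] [BorelSpace E]

theorem measure_hyperplane_eq_zero (μ : Measure E) [μ.IsAddHaarMeasure] {f : StrongDual ℝ E}
    (hf : f ≠ 0) (c : ℝ) : μ {x | f x = c} = 0 := by
  by_cases hc : ∃ x, f x = c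
  · obtain ⟨x₀, hx₀⟩ := hc
    have : {x | f x = c} = (fun x => x₀ + x) '' (f.ker : Set E) := by
      ext x
      simp only [mem_ofPred_eq, image_add_left, mem_preimage, SetLike.mem_coe]
      show f x = c ↔ f (-x₀ + x) = 0
      rw [map_add, map_neg, hx₀]
      constructor <;> intro h <;> linarith
    rw [this, image_add_left, measure_preimage_add]
    refine Measure.addHaar_submodule μ _ fun h => hf ?_
    ext x
    have : x ∈ f.ker := by rw [h]; trivial
    exact this
  · have : {x | f x = c} = ∅ := by
      ext x
      simpa using fun h => hc ⟨x, h⟩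
    simp [this]

theorem Convex.interior_nonempty_of_measure_pos (μ : Measure E) [μ.IsAddHaarMeasure] {A : Set E}
    (hA : Convex ℝ A) (h : 0 < μ A) : (interior A).Nonempty := by
  by_contra hne
  rw [not_nonempty_iff_eq_empty] at hne
  have h1 : A ⊆ frontier A := by
    rw [frontier, hne, sdiff_empty]
    exact subset_closure
  have := measure_mono_null h1 (hA.addHaar_frontier μ)
  exact h.ne' this

/-- Continuity holds because hyperplanes are null. If the function is constant on [x, y], the open
slab x < f < y misses the interior of `A`; that interior is connected, so it lies on one side, and
the boundary of `A` is null. -/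
theorem Convex.isStrictDistribution (μ : Measure E) [μ.IsAddHaarMeasure] {A : Set E}
    (hA : Convex ℝ A) (hAc : IsCompact A) (hpos : 0 < μ A) {f : StrongDual ℝ E} (hf : f ≠ 0) :
    IsStrictDistribution (μ.real A) fun s => μ.real (A ∩ {x | f x ≤ s}) := by
  have hfin : μ A ≠ ∞ := hAc.measure_ne_top
  have hint := hA.interior_nonempty_of_measure_pos μ hpos
  have hmono : Monotone fun s => μ.real (A ∩ {x | f x ≤ s}) := fun s t hst =>
    measureReal_mono (inter_subset_inter_right _ fun x (hx : f x ≤ s) => hx.trans hst)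
      (measure_ne_top_of_subset inter_subset_left hfin)
  have hms : ∀ s, MeasurableSet {x | f x ≤ s} := fun s =>
    measurableSet_le f.continuous.measurable measurable_const
  have hμint : μ (interior A) = μ A := by
    refine le_antisymm (measure_mono interior_subset) ?_
    calc μ A ≤ μ (interior A ∪ frontier A) := measure_mono (by
            rw [← closure_eq_interior_union_frontier]; exact subset_closure)
      _ ≤ μ (interior A) + μ (frontier A) := measure_union_le _ _
      _ = μ (interior A) := by rw [hA.addHaar_frontier μ, add_zero]
  refine ⟨?_, hmono, fun s => measureReal_nonneg, fun s => measureReal_mono inter_subset_left hfin,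
    ?_, ?_, ?_⟩
  · have heq : (fun s => μ.real (A ∩ {x | f x ≤ s})) =
        fun s => ∫ x in A, ({x | f x ≤ s}.indicator (fun _ => (1 : ℝ)) x) ∂μ := by
      funext s
      rw [integral_indicator (hms s), setIntegral_const, smul_eq_mul, mul_one,
        measureReal_restrict_apply (hms s), inter_comm]
    rw [heq]
    have : IsFiniteMeasure (μ.restrict A) := ⟨by simpa using hfin.lt_top⟩
    refine continuous_iff_continuousAt.2 fun s => ?_
    refine continuousAt_of_dominated (bound := fun _ => 1) ?_ ?_ (integrable_const 1) ?_
    · exact .of_forall fun t => ((measurable_const.indicator (hms t)).aestronglyMeasurable)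
    · refine .of_forall fun t => .of_forall fun x => ?_
      by_cases hx : f x ≤ t <;> simp [indicator, hx]
    · have h0 : ∀ᵐ x ∂(μ.restrict A), f x ≠ s := by
        refine ae_restrict_of_ae ?_
        rw [ae_iff]
        simpa using measure_hyperplane_eq_zero μ hf s
      filter_upwards [h0] with x hx
      rcases lt_or_gt_of_ne hx with h | h
      · refine (continuousAt_const (y := (1 : ℝ))).congr ?_
        filter_upwards [lt_mem_nhds h] with t ht
        simp [indicator, ht.le]
      · refine (continuousAt_const (y := (0 : ℝ))).congr ?_
        filter_upwards [gt_mem_nhds h] with t ht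
        simp [indicator, ht]
  · obtain ⟨m, hm⟩ := (hAc.image f.continuous).bddBelow
    refine ⟨m - 1, ?_⟩
    have : A ∩ {x | f x ≤ m - 1} = ∅ := by
      ext x
      simp only [mem_inter_iff, mem_ofPred_eq, mem_empty_iff_false, iff_false, not_and, not_le]
      intro hx
      have := hm (mem_image_of_mem f hx)
      linarith
    simp [this]
  · obtain ⟨m, hm⟩ := (hAc.image f.continuous).bddAbove
    refine ⟨m, ?_⟩
    have : A ∩ {x | f x ≤ m} = A := inter_eq_left.2 fun x hx => hm (mem_image_of_mem f hx)
    simp [this]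
  · intro x y hxy hN
    have hsub : A ∩ {z | f z ≤ x} ⊆ A ∩ {z | f z ≤ y} :=
      inter_subset_inter_right _ fun z (hz : f z ≤ x) => hz.trans hxy.le
    have hdiff : μ ((A ∩ {z | f z ≤ y}) \ (A ∩ {z | f z ≤ x})) = 0 := by
      have hne : ∀ s, μ (A ∩ {x | f x ≤ s}) ≠ ∞ := fun s =>
        measure_ne_top_of_subset inter_subset_left hfin
      have h1 := measureReal_sdiff hsub (hAc.measurableSet.inter (hms x)) (hne y)
      have h2 : μ.real ((A ∩ {z | f z ≤ y}) \ (A ∩ {z | f z ≤ x})) = 0 := by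
        rw [h1]; linarith
      rwa [measureReal_eq_zero_iff (measure_ne_top_of_subset sdiff_subset (hne y))] at h2
    have hemp : interior A ∩ {z | x < f z ∧ f z < y} = ∅ := by
      have ho : IsOpen (interior A ∩ {z | x < f z ∧ f z < y}) :=
        isOpen_interior.inter ((isOpen_lt continuous_const f.continuous).inter
          (isOpen_lt f.continuous continuous_const))
      refine (ho.measure_eq_zero_iff μ).1 (measure_mono_null ?_ hdiff)
      rintro z ⟨hz, h1, h2⟩
      exact ⟨⟨interior_subset hz, h2.le⟩, fun h => absurd h.2 (not_le.2 h1)⟩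
    have hpre : IsPreconnected (f '' interior A) :=
      hA.interior.isPreconnected.image _ f.continuous.continuousOn
    by_cases hp : ∃ p ∈ interior A, f p ≤ x
    · right
      obtain ⟨p, hp, hpx⟩ := hp
      have hall : interior A ⊆ A ∩ {z | f z ≤ x} := fun q hq => by
        refine ⟨interior_subset hq, ?_⟩
        by_contra! hqx
        have hqx : x < f q := by simpa using hqx
        obtain ⟨m, hm1, hm2⟩ := exists_between (lt_min hqx hxy)
        obtain ⟨z, hz, hzm⟩ := hpre.Icc_subset (mem_image_of_mem f hp) (mem_image_of_mem f hq)
          (show m ∈ Icc (f p) (f q) from ⟨by linarith, (hm2.le.trans (min_le_left _ _))⟩)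
        have : z ∈ interior A ∩ {z | x < f z ∧ f z < y} :=
          ⟨hz, by rw [hzm]; exact hm1, by rw [hzm]; exact hm2.trans_le (min_le_right _ _)⟩
        rw [hemp] at this
        exact this
      refine le_antisymm (measureReal_mono inter_subset_left hfin) ?_
      rw [measureReal_def, ← hμint]
      exact measureReal_mono hall (measure_ne_top_of_subset inter_subset_left hfin)
    · left
      push Not at hp
      have h0 : A ∩ {z | f z ≤ x} ⊆ frontier A := fun z hz => by
        rw [frontier]
        exact ⟨subset_closure hz.1, fun h => absurd hz.2 (not_le.2 (hp z h))⟩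
      simp only [measureReal_def]
      rw [measure_mono_null h0 (hA.addHaar_frontier μ), ENNReal.toReal_zero]

/-- Midpoints of the parts of `A` and `B` below levels s and t lie in the part of `C` below (s +
t)/2, and likewise above. Brunn–Minkowski for both pairs gives the hypotheses of
`IsStrictDistribution.exists_shift`. -/
theorem Convex.exists_eq_shift_of_measure_midpoint_eq (μ : Measure E) [μ.IsAddHaarMeasure]
    {A B C : Set E} (hA : Convex ℝ A) (hAc : IsCompact A) (hB : Convex ℝ B) (hBc : IsCompact B)
    (hC : Convex ℝ C) (hCc : IsCompact C) (hABC : ∀ x ∈ A, ∀ y ∈ B, (2⁻¹ : ℝ) • (x + y) ∈ C)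
    (hpos : 0 < μ A) (hAB : μ B = μ A) (hAC : μ C = μ A) {f : StrongDual ℝ E} (hf : f ≠ 0) :
    ∃ κ, ∀ s, μ.real (A ∩ {x | f x ≤ s}) = μ.real (B ∩ {x | f x ≤ s - κ}) := by
  have hAd := hA.isStrictDistribution μ hAc hpos hf
  have hBd := hB.isStrictDistribution μ hBc (hAB ▸ hpos) hf
  have hCd := hC.isStrictDistribution μ hCc (hAC ▸ hpos) hf
  rw [measureReal_def, hAB, ← measureReal_def] at hBd
  rw [measureReal_def, hAC, ← measureReal_def] at hCd
  have hms : ∀ s, MeasurableSet {x | f x ≤ s} := fun s =>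
    measurableSet_le f.continuous.measurable measurable_const
  have hms' : ∀ s, MeasurableSet {x | s < f x} := fun s =>
    measurableSet_lt measurable_const f.continuous.measurable
  have hcompl : ∀ D : Set E, IsCompact D → ∀ s,
      μ.real (D ∩ {x | s < f x}) = μ.real D - μ.real (D ∩ {x | f x ≤ s}) := fun D hD s => by
    have := measureReal_inter_add_sdiff (μ := μ) (s := D) (t := {x | f x ≤ s}) (hms s)
      hD.measure_ne_top
    have h2 : D \ {x | f x ≤ s} = D ∩ {x | s < f x} := by ext; simp
    rw [h2] at this
    linarith
  have hreal : ∀ D : Set E, μ D = μ A → μ.real D = μ.real A := fun D hD => by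
    rw [measureReal_def, hD, measureReal_def]
  have hBM : ∀ K L U : Set E, MeasurableSet K → MeasurableSet L → MeasurableSet U → μ U ≠ ∞ →
      (∀ x ∈ K, ∀ y ∈ L, (2⁻¹ : ℝ) • (x + y) ∈ U) → μ.real K * μ.real L ≤ μ.real U ^ 2 := by
    intro K L U hK hL hU hfin h
    have := ENNReal.toReal_mono (ENNReal.pow_ne_top hfin)
      (measure_mul_measure_le_sq_of_midpoint μ hK hL hU h)
    simpa [measureReal_def] using this
  have hfC : ∀ S, μ (C ∩ S) ≠ ∞ := fun S => measure_ne_top_of_subset inter_subset_left hCc.measure_ne_top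
  refine IsStrictDistribution.exists_shift hAd hBd hCd (fun s t => ?_) (fun s t => ?_)
  · refine hBM _ _ _ (hAc.measurableSet.inter (hms s)) (hBc.measurableSet.inter (hms t))
      (hCc.measurableSet.inter (hms _)) (hfC _) ?_
    rintro x ⟨hx, hxs⟩ y ⟨hy, hys⟩
    refine ⟨hABC x hx y hy, ?_⟩
    simp only [mem_ofPred_eq, map_smul, map_add, smul_eq_mul] at *
    linarith
  · have e1 := hcompl A hAc s
    have e2 := hcompl B hBc t
    have e3 := hcompl C hCc ((s + t) / 2)
    rw [hreal B hAB] at e2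
    rw [hreal C hAC] at e3
    simp only [← e1, ← e2, ← e3]
    refine hBM _ _ _ (hAc.measurableSet.inter (hms' s)) (hBc.measurableSet.inter (hms' t))
      (hCc.measurableSet.inter (hms' _)) (hfC _) ?_
    rintro x ⟨hx, hxs⟩ y ⟨hy, hys⟩
    refine ⟨hABC x hx y hy, ?_⟩
    simp only [mem_ofPred_eq, map_smul, map_add, smul_eq_mul] at *
    linarith

/-- If y - z is separated from `B` by f at level u, then all of `B` lies below u, so the part of `A`
above u + f z is null. Yet y lies there and in the closure of the interior of `A`, so that part
contains a nonempty open set. -/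
theorem Convex.subset_vadd_of_distribution_eq (μ : Measure E) [μ.IsAddHaarMeasure]
    {A B : Set E} (hA : Convex ℝ A) (hB : Convex ℝ B) (hBc : IsCompact B)
    (hAc : IsCompact A) (hpos : 0 < μ A) (hAB : μ B = μ A) {z : E}
    (h : ∀ f : StrongDual ℝ E, f ≠ 0 → ∀ s,
      μ.real (A ∩ {x | f x ≤ s}) = μ.real (B ∩ {x | f x ≤ s - f z})) :
    ∀ y ∈ A, y - z ∈ B := by
  intro y hy
  by_contra hyB
  obtain ⟨f, u, hfu, huy⟩ := geometric_hahn_banach_closed_point hB hBc.isClosed hyB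
  have hBne : B.Nonempty := nonempty_of_measure_ne_zero (hAB ▸ hpos.ne')
  obtain ⟨b, hb⟩ := hBne
  have hf : f ≠ 0 := fun h0 => by
    have h1 := hfu b hb
    rw [h0] at h1 huy
    simp only [zero_apply] at h1 huy
    linarith
  have h1 := h f hf (u + f z)
  have hBu : B ∩ {x | f x ≤ u} = B := inter_eq_left.2 fun x hx => (hfu x hx).le
  rw [add_sub_cancel_right, hBu,
    measureReal_def, measureReal_def, hAB, ENNReal.toReal_eq_toReal_iff'
    (measure_ne_top_of_subset inter_subset_left hAc.measure_ne_top) hAc.measure_ne_top] at h1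
  have hms : MeasurableSet {x | f x ≤ u + f z} :=
    measurableSet_le f.continuous.measurable measurable_const
  have h2 : μ (A \ {x | f x ≤ u + f z}) = 0 := by
    have h3 := measure_inter_add_sdiff (μ := μ) A hms
    rw [h1] at h3
    exact (ENNReal.add_right_inj hAc.measure_ne_top).1 (h3.trans (add_zero _).symm)
  have hint := hA.interior_nonempty_of_measure_pos μ hpos
  have hycl : y ∈ closure (interior A) := by
    rw [hA.closure_interior_eq_closure_of_nonempty_interior hint]
    exact subset_closure hy
  have ho : IsOpen {x | u + f z < f x} := isOpen_lt continuous_const f.continuous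
  have hyu : y ∈ {x | u + f z < f x} := by
    simp only [map_sub] at huy
    simp only [mem_ofPred_eq]
    linarith
  have hne := mem_closure_iff.1 hycl _ ho hyu
  have := (ho.inter isOpen_interior).measure_pos μ hne
  refine this.ne' (measure_mono_null ?_ h2)
  rintro x ⟨hx1, hx2⟩
  exact ⟨interior_subset hx2, fun h : f x ≤ u + f z => absurd hx1 (not_lt.2 h)⟩

/-- The equality case of the Brunn–Minkowski inequality for two convex bodies of equal volume. -/
theorem Convex.exists_translate_of_measure_midpoint_eq (μ : Measure E) [μ.IsAddHaarMeasure]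
    {A B C : Set E} (hA : Convex ℝ A) (hAc : IsCompact A) (hB : Convex ℝ B) (hBc : IsCompact B)
    (hC : Convex ℝ C) (hCc : IsCompact C) (hABC : ∀ x ∈ A, ∀ y ∈ B, (2⁻¹ : ℝ) • (x + y) ∈ C)
    (hpos : 0 < μ A) (hAB : μ B = μ A) (hAC : μ C = μ A) :
    ∃ z, A = (fun x => z + x) '' B := by
  have hfin : μ A ≠ ∞ := hAc.measure_ne_top
  have ha : 0 < μ.real A := ENNReal.toReal_pos hpos.ne' hfin
  have hfA : IsFiniteMeasure (μ.restrict A) := ⟨by simpa using hfin.lt_top⟩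
  have hfB : IsFiniteMeasure (μ.restrict B) := ⟨by simpa using hBc.measure_lt_top⟩
  have hintA : IntegrableOn (fun x : E => x) A μ := continuousOn_id.integrableOn_compact hAc
  have hintB : IntegrableOn (fun x : E => x) B μ := continuousOn_id.integrableOn_compact hBc
  -- The shift κ depends on f; equating the means of f over `A` and `B` shows κ = f z, with z the
  -- difference of the centroids.
  set z := (μ.real A)⁻¹ • ((∫ x in A, x ∂μ) - ∫ x in B, x ∂μ) with hz
  have key : ∀ f : StrongDual ℝ E, f ≠ 0 → ∀ s,
      μ.real (A ∩ {x | f x ≤ s}) = μ.real (B ∩ {x | f x ≤ s - f z}) := by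
    intro f hf
    obtain ⟨κ, hκ⟩ := hA.exists_eq_shift_of_measure_midpoint_eq μ hAc hB hBc hC hCc hABC hpos hAB
      hAC hf
    suffices hfz : f z = κ by rwa [hfz]
    have hmA : Measurable f := f.continuous.measurable
    have hmB : Measurable fun x => f x + κ := hmA.add_const κ
    have hmap : (μ.restrict A).map f = (μ.restrict B).map fun x => f x + κ := by
      refine Measure.ext_of_Iic _ _ fun s => ?_
      rw [Measure.map_apply hmA measurableSet_Iic, Measure.map_apply hmB measurableSet_Iic,
        Measure.restrict_apply (hmA measurableSet_Iic),
        Measure.restrict_apply (hmB measurableSet_Iic)]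
      have h1 : f ⁻¹' Iic s ∩ A = A ∩ {x | f x ≤ s} := inter_comm _ _
      have h2 : (fun x => f x + κ) ⁻¹' Iic s ∩ B = B ∩ {x | f x ≤ s - κ} := by
        ext x
        simp [le_sub_iff_add_le, and_comm]
      rw [h1, h2]
      exact (ENNReal.toReal_eq_toReal_iff'
        (measure_ne_top_of_subset inter_subset_left hfin)
        (measure_ne_top_of_subset inter_subset_left hBc.measure_ne_top)).1 (hκ s)
    have hI : ∫ x in A, f x ∂μ = ∫ x in B, (f x + κ) ∂μ := by
      have h1 := integral_map (μ := μ.restrict A) hmA.aemeasurable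
        (f := fun y : ℝ => y) aestronglyMeasurable_id
      have h2 := integral_map (μ := μ.restrict B) hmB.aemeasurable
        (f := fun y : ℝ => y) aestronglyMeasurable_id
      rw [← h1, ← h2, hmap]
    rw [integral_add (f.integrable_comp hintB) (integrable_const κ), setIntegral_const,
      smul_eq_mul, f.integral_comp_comm hintA, f.integral_comp_comm hintB] at hI
    have hBA : μ.real B = μ.real A := by rw [measureReal_def, hAB, measureReal_def]
    rw [hz, map_smul, map_sub, hI, hBA, smul_eq_mul]
    field_simp
    ring
  refine ⟨z, Subset.antisymm (fun y hy => ?_) ?_⟩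
  · exact ⟨y - z, hA.subset_vadd_of_distribution_eq μ hB hBc hAc hpos hAB key y hy, by simp⟩
  · rintro _ ⟨y, hy, rfl⟩
    have := hB.subset_vadd_of_distribution_eq μ hA hAc hBc (hAB ▸ hpos) hAB.symm (z := -z)
      (fun f hf s => by rw [key f hf, map_neg, sub_neg_eq_add, add_sub_cancel_right]) y hy
    rwa [sub_neg_eq_add, add_comm] at this

end Body

/-! ### Translates up to a point reflection -/

section SignedTranslate

variable {E : Type*} [AddCommGroup E]

/-- `Y` is a translate of `X` or of `-X`. -/
def IsSignedTranslate (X Y : Set E) : Prop :=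
  ∃ t, Y = (fun x => t + x) '' X ∨ Y = (fun x => t - x) '' X

/-- `X` is invariant under a point reflection. -/
def IsPointSymmetric (X : Set E) : Prop := ∃ t, X = (fun x => t - x) '' X

theorem IsSignedTranslate.refl (X : Set E) : IsSignedTranslate X X := ⟨0, Or.inl (by simp)⟩

theorem IsSignedTranslate.symm {X Y : Set E} (h : IsSignedTranslate X Y) :
    IsSignedTranslate Y X := by
  obtain ⟨t, rfl | rfl⟩ := h
  · exact ⟨-t, Or.inl (by rw [image_image]; simp)⟩
  · exact ⟨t, Or.inr (by rw [image_image]; simp)⟩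

theorem IsSignedTranslate.trans {X Y Z : Set E} (h : IsSignedTranslate X Y)
    (h' : IsSignedTranslate Y Z) : IsSignedTranslate X Z := by
  obtain ⟨t, rfl | rfl⟩ := h <;> obtain ⟨s, rfl | rfl⟩ := h'
  · exact ⟨s + t, Or.inl (by simp only [image_image, add_assoc])⟩
  · exact ⟨s - t, Or.inr (by simp only [image_image, sub_sub])⟩
  · exact ⟨s + t, Or.inr (by simp only [image_image, add_sub_assoc])⟩
  · exact ⟨s - t, Or.inl (by simp only [image_image]; congr 1; ext x; abel)⟩

end SignedTranslate

/-! ### Faces of polytopes cut out by linear functionals -/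

section Faces

variable {E : Type*} [AddCommGroup E] [Module ℝ E]

/-- The face of `P` on which the linear functional `f` attains its maximum over `P`. -/
def maxFace (P : Set E) (f : Module.Dual ℝ E) : Set E := {x ∈ P | ∀ y ∈ P, f y ≤ f x}

/-- The convex hull of a finite nonempty set, in an arbitrary real vector space. -/
def IsPolytope (P : Set E) : Prop := ∃ V : Set E, V.Finite ∧ V.Nonempty ∧ P = convexHull ℝ V

theorem maxFace_subset (P : Set E) (f : Module.Dual ℝ E) : maxFace P f ⊆ P := fun _ h => h.1

theorem apply_eq_of_mem_maxFace {P : Set E} {f : Module.Dual ℝ E} {x y : E}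
    (hx : x ∈ maxFace P f) (hy : y ∈ maxFace P f) : f x = f y :=
  le_antisymm (hy.2 x hx.1) (hx.2 y hy.1)

theorem mem_maxFace_of_apply_eq {P : Set E} {f : Module.Dual ℝ E} {x y : E}
    (hx : x ∈ maxFace P f) (hy : y ∈ P) (h : f y = f x) : y ∈ maxFace P f :=
  ⟨hy, fun z hz => h ▸ hx.2 z hz⟩

theorem maxFace_smul (P : Set E) (f : Module.Dual ℝ E) {c : ℝ} (hc : 0 < c) :
    maxFace P (c • f) = maxFace P f := by
  ext x
  simp only [maxFace, mem_ofPred_eq, LinearMap.smul_apply, smul_eq_mul, mul_le_mul_iff_right₀ hc]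

theorem maxFace_eq_self {P : Set E} {f : Module.Dual ℝ E} (h : ∀ x ∈ P, ∀ y ∈ P, f x = f y) :
    maxFace P f = P :=
  Subset.antisymm (maxFace_subset P f) fun x hx => ⟨hx, fun y hy => (h y hy x hx).le⟩

theorem maxFace_add_image (t : E) (P : Set E) (f : Module.Dual ℝ E) :
    maxFace ((fun x => t + x) '' P) f = (fun x => t + x) '' maxFace P f := by
  ext x
  constructor
  · rintro ⟨⟨y, hy, rfl⟩, h⟩
    exact ⟨y, ⟨hy, fun z hz => by simpa using h _ (mem_image_of_mem _ hz)⟩, rfl⟩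
  · rintro ⟨y, ⟨hy, h⟩, rfl⟩
    refine ⟨mem_image_of_mem _ hy, ?_⟩
    rintro _ ⟨z, hz, rfl⟩
    simpa using h z hz

theorem maxFace_sub_image (t : E) (P : Set E) (f : Module.Dual ℝ E) :
    maxFace ((fun x => t - x) '' P) f = (fun x => t - x) '' maxFace P (-f) := by
  ext x
  constructor
  · rintro ⟨⟨y, hy, rfl⟩, h⟩
    exact ⟨y, ⟨hy, fun z hz => by
      have := h _ (mem_image_of_mem _ hz)
      simp only [map_sub] at this
      simp only [LinearMap.neg_apply]
      linarith⟩, rfl⟩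
  · rintro ⟨y, ⟨hy, h⟩, rfl⟩
    refine ⟨mem_image_of_mem _ hy, ?_⟩
    rintro _ ⟨z, hz, rfl⟩
    have := h z hz
    simp only [LinearMap.neg_apply] at this
    simp only [map_sub]
    linarith

theorem vectorSpan_add_image (t : E) (P : Set E) :
    vectorSpan ℝ ((fun x => t + x) '' P) = vectorSpan ℝ P :=
  vectorSpan_vadd ℝ P t

theorem vectorSpan_sub_image (t : E) (P : Set E) :
    vectorSpan ℝ ((fun x => t - x) '' P) = vectorSpan ℝ P := by
  have h := AffineMap.map_vectorSpan
    (AffineMap.const ℝ E t - AffineMap.id ℝ E) (s := P)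
  have h1 : (⇑(AffineMap.const ℝ E t - AffineMap.id ℝ E) : E → E) = fun x => t - x := by
    ext x; simp
  have h2 : (AffineMap.const ℝ E t - AffineMap.id ℝ E).linear = -LinearMap.id := by
    ext x; simp
  rw [h1, h2] at h
  rw [← h]
  ext x
  simp only [Submodule.mem_map, LinearMap.neg_apply, LinearMap.id_apply]
  constructor
  · rintro ⟨y, hy, rfl⟩
    exact neg_mem hy
  · exact fun hx => ⟨-x, neg_mem hx, neg_neg x⟩

theorem IsSignedTranslate.vectorSpan_eq {X Y : Set E} (h : IsSignedTranslate X Y) :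
    vectorSpan ℝ Y = vectorSpan ℝ X := by
  obtain ⟨t, rfl | rfl⟩ := h
  · exact vectorSpan_add_image t X
  · exact vectorSpan_sub_image t X

theorem maxFace_convexHull {V : Set E} (hV : V.Finite) (f : Module.Dual ℝ E) :
    maxFace (convexHull ℝ V) f = convexHull ℝ (maxFace V f) := by
  rcases V.eq_empty_or_nonempty with rfl | hne
  · simp [maxFace]
  obtain ⟨v₀, hv₀, hmax⟩ := hV.exists_maximalFor f V hne
  have hle : ∀ v ∈ V, f v ≤ f v₀ := fun v hv => by
    by_contra! h
    exact absurd (hmax hv h.le) (not_le.2 h)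
  have hle' : ∀ x ∈ convexHull ℝ V, f x ≤ f v₀ := fun x hx =>
    convexHull_min (t := {x | f x ≤ f v₀}) hle (convex_halfSpace_le f.isLinear _) hx
  have hv₀' : v₀ ∈ maxFace V f := ⟨hv₀, hle⟩
  apply Subset.antisymm
  · rintro x ⟨hx, hxm⟩
    have hxv : f x = f v₀ := le_antisymm (hle' x hx) (hxm v₀ (subset_convexHull ℝ V hv₀))
    by_cases hW : (V \ maxFace V f).Nonempty
    · have hVu : V = maxFace V f ∪ (V \ maxFace V f) := by
        rw [union_sdiff_cancel (maxFace_subset V f)]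
      rw [hVu, convexHull_union ⟨v₀, hv₀'⟩ hW, mem_convexJoin] at hx
      obtain ⟨p, hp, q, hq, hpq⟩ := hx
      obtain ⟨a, b, ha, hb, hab, rfl⟩ := hpq
      have hfp : f p ≤ f v₀ := hle' p (convexHull_mono (maxFace_subset V f) hp)
      have hfq : f q < f v₀ := by
        refine convexHull_min (t := {x | f x < f v₀}) ?_ (convex_halfSpace_lt f.isLinear _) hq
        intro v hv
        refine lt_of_le_of_ne (hle v hv.1) fun h => hv.2 ?_
        exact mem_maxFace_of_apply_eq hv₀' hv.1 h
      have hb0 : b = 0 := by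
        by_contra hb0
        have : 0 < b := lt_of_le_of_ne hb (Ne.symm hb0)
        simp only [map_add, map_smul, smul_eq_mul] at hxv
        have h3 : a * f p ≤ a * f v₀ := mul_le_mul_of_nonneg_left hfp ha
        have h4 : b * f q < b * f v₀ := mul_lt_mul_of_pos_left hfq this
        have h5 : a * f v₀ + b * f v₀ = f v₀ := by rw [← add_mul, hab, one_mul]
        linarith
      have ha1 : a = 1 := by linarith
      simpa [hb0, ha1] using hp
    · rw [not_nonempty_iff_eq_empty, sdiff_eq_empty] at hW
      exact convexHull_mono hW hx
  · refine convexHull_min (fun v hv => ⟨subset_convexHull ℝ V hv.1, fun y hy => ?_⟩) ?_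
    · exact (hle' y hy).trans (hv.2 v₀ hv₀)
    · intro x hx y hy a b ha hb hab
      refine ⟨convex_convexHull ℝ V hx.1 hy.1 ha hb hab, fun z hz => ?_⟩
      have h1 := hx.2 z hz
      have h2 := hy.2 z hz
      simp only [map_add, map_smul, smul_eq_mul]
      have : b = 1 - a := by linarith
      subst this
      nlinarith

theorem IsPolytope.face {P : Set E} (hP : IsPolytope P) (f : Module.Dual ℝ E) :
    IsPolytope (maxFace P f) := by
  obtain ⟨V, hV, hne, rfl⟩ := hP
  refine ⟨maxFace V f, hV.subset (maxFace_subset V f), ?_, maxFace_convexHull hV f⟩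
  obtain ⟨v₀, hv₀, hmax⟩ := hV.exists_maximalFor f V hne
  refine ⟨v₀, hv₀, fun v hv => ?_⟩
  by_contra! h
  exact absurd (hmax hv h.le) (not_le.2 h)

theorem IsPolytope.nonempty {P : Set E} (hP : IsPolytope P) : P.Nonempty := by
  obtain ⟨V, hV, hne, rfl⟩ := hP
  exact hne.convexHull

theorem IsPolytope.convex {P : Set E} (hP : IsPolytope P) : Convex ℝ P := by
  obtain ⟨V, hV, hne, rfl⟩ := hP
  exact convex_convexHull ℝ V

theorem IsPolytope.finite_range_maxFace {P : Set E} (hP : IsPolytope P) :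
    (range fun f : Module.Dual ℝ E => maxFace P f).Finite := by
  obtain ⟨V, hV, hne, rfl⟩ := hP
  refine (hV.finite_subsets.image (convexHull ℝ)).subset ?_
  rintro _ ⟨f, rfl⟩
  exact ⟨maxFace V f, maxFace_subset V f, (maxFace_convexHull hV f).symm⟩

theorem IsPolytope.affine_image {F : Type*} [AddCommGroup F] [Module ℝ F] {P : Set E}
    (hP : IsPolytope P) (φ : E →ᵃ[ℝ] F) : IsPolytope (φ '' P) := by
  obtain ⟨V, hV, hne, rfl⟩ := hP
  exact ⟨φ '' V, hV.image φ, hne.image φ, φ.image_convexHull V⟩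

theorem IsPolytope.add_image {P : Set E} (hP : IsPolytope P) (t : E) :
    IsPolytope ((fun x => t + x) '' P) := by
  convert hP.affine_image (AffineMap.const ℝ E t + AffineMap.id ℝ E) using 2
  simp

theorem IsPolytope.sub_image {P : Set E} (hP : IsPolytope P) (t : E) :
    IsPolytope ((fun x => t - x) '' P) := by
  convert hP.affine_image (AffineMap.const ℝ E t - AffineMap.id ℝ E) using 2
  simp

/-- For small ε > 0 the maximum is lexicographic: finitely many strict inequalities for f survive
the perturbation, and g only breaks ties. -/
theorem eventually_maxFace_add_smul_of_finite {V : Set E} (hV : V.Finite) (f g : Module.Dual ℝ E) :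
    ∀ᶠ ε : ℝ in 𝓝[>] 0, maxFace V (f + ε • g) = maxFace (maxFace V f) g := by
  have h : ∀ᶠ ε : ℝ in 𝓝[>] 0, ∀ x ∈ V, ∀ y ∈ V, f y < f x → (f + ε • g) y < (f + ε • g) x := by
    rw [Filter.eventually_all_finite hV]
    intro x _
    rw [Filter.eventually_all_finite hV]
    intro y _
    by_cases hxy : f y < f x
    · have hc : Filter.Tendsto (fun ε : ℝ => (f + ε • g) x - (f + ε • g) y) (𝓝[>] 0)
          (𝓝 (f x - f y)) := by
        have : Continuous fun ε : ℝ => (f + ε • g) x - (f + ε • g) y := by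
          simp only [LinearMap.add_apply, LinearMap.smul_apply, smul_eq_mul]
          fun_prop
        have h0 := this.tendsto 0
        simp only [zero_smul, add_zero] at h0
        exact h0.mono_left nhdsWithin_le_nhds
      filter_upwards [hc.eventually_const_lt (sub_pos.2 hxy)] with ε hε _
      linarith
    · exact .of_forall fun ε h => absurd h hxy
  filter_upwards [h, self_mem_nhdsWithin] with ε hε hε0
  rw [mem_Ioi] at hε0
  ext x
  constructor
  · rintro ⟨hx, hxm⟩
    have hxf : x ∈ maxFace V f := ⟨hx, fun y hy => by
      by_contra! hlt
      exact absurd (hxm y hy) (not_le.2 (hε y hy x hx hlt))⟩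
    refine ⟨hxf, fun y hy => ?_⟩
    have h1 := hxm y hy.1
    have h2 := apply_eq_of_mem_maxFace hxf hy
    simp only [LinearMap.add_apply, LinearMap.smul_apply, smul_eq_mul] at h1
    nlinarith
  · rintro ⟨hxf, hxg⟩
    refine ⟨hxf.1, fun y hy => ?_⟩
    rcases lt_or_eq_of_le (hxf.2 y hy) with hlt | heq
    · exact (hε x hxf.1 y hy hlt).le
    · have := hxg y (mem_maxFace_of_apply_eq hxf hy heq)
      simp only [LinearMap.add_apply, LinearMap.smul_apply, smul_eq_mul]
      nlinarith

theorem IsPolytope.eventually_maxFace_add_smul {P : Set E} (hP : IsPolytope P)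
    (f g : Module.Dual ℝ E) :
    ∀ᶠ ε : ℝ in 𝓝[>] 0, maxFace P (f + ε • g) = maxFace (maxFace P f) g := by
  obtain ⟨V, hV, hne, rfl⟩ := hP
  filter_upwards [eventually_maxFace_add_smul_of_finite hV f g] with ε hε
  rw [maxFace_convexHull hV, hε, maxFace_convexHull hV,
    maxFace_convexHull (hV.subset (maxFace_subset V f))]

theorem vectorSpan_maxFace_le_ker (P : Set E) (f : Module.Dual ℝ E) :
    vectorSpan ℝ (maxFace P f) ≤ LinearMap.ker f := by
  rw [vectorSpan, Submodule.span_le]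
  rintro _ ⟨x, hx, y, hy, rfl⟩
  simp [apply_eq_of_mem_maxFace hx hy]

theorem apply_eq_of_vectorSpan_le_ker {X : Set E} {f : Module.Dual ℝ E}
    (h : vectorSpan ℝ X ≤ LinearMap.ker f) {x y : E} (hx : x ∈ X) (hy : y ∈ X) : f x = f y := by
  have := h (vsub_mem_vectorSpan ℝ hx hy)
  simpa [sub_eq_zero] using this

end Faces

/-! ### Decomposition of a polytope into cones over its facets -/

section Cover

variable {E : Type*} [NormedAddCommGroup E] [NormedSpace ℝ E]

theorem IsPolytope.isCompact {A : Set E} (hA : IsPolytope A) : IsCompact A := by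
  obtain ⟨V, hV, hne, rfl⟩ := hA
  exact hV.isCompact_convexHull ℝ

/-- `v` defines a facet of `A`. -/
def IsFacetFunctional (A : Set E) (v : Module.Dual ℝ E) : Prop :=
  Module.finrank ℝ (vectorSpan ℝ (maxFace A v)) + 1 = Module.finrank ℝ E

/-- The facet functionals of `A` whose maximum over `A` is `1`. -/
def facetNormals (A : Set E) : Set (Module.Dual ℝ E) :=
  {v | IsFacetFunctional A v ∧ ∀ x ∈ maxFace A v, v x = 1}

/-- The part of `A` in the cone spanned by the facet with normal `v`. -/
def facetCone (A : Set E) (v : Module.Dual ℝ E) : Set E := {x ∈ A | gauge A x ≤ v x}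

theorem gauge_pos_of_ne_zero {A : Set E} (hAc : IsCompact A)
    (h0 : (0 : E) ∈ interior A) {x : E} (hx : x ≠ 0) : 0 < gauge A x :=
  (gauge_pos (absorbent_nhds_zero (mem_interior_iff_mem_nhds.1 h0))
    (NormedSpace.isVonNBounded_iff ℝ |>.2 hAc.isBounded)).2 hx

theorem IsPolytope.ne_zero_of_mem_facetNormals {A : Set E} (hA : IsPolytope A)
    {v : Module.Dual ℝ E} (hv : v ∈ facetNormals A) : v ≠ 0 := by
  rintro rfl
  obtain ⟨x, hx⟩ := (hA.face 0).nonempty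
  simpa using hv.2 x hx

theorem gauge_le_one_iff_mem {A : Set E} (hA : Convex ℝ A) (hAc : IsCompact A)
    (h0 : (0 : E) ∈ interior A) (x : E) : gauge A x ≤ 1 ↔ x ∈ A := by
  rw [gauge_le_one_iff_mem_closure hA (mem_interior_iff_mem_nhds.1 h0), hAc.isClosed.closure_eq]

theorem inv_gauge_smul_mem {A : Set E} (hA : Convex ℝ A) (hAc : IsCompact A)
    (h0 : (0 : E) ∈ interior A) {x : E} (hx : x ≠ 0) : (gauge A x)⁻¹ • x ∈ A := by
  have hg := gauge_pos_of_ne_zero hAc h0 hx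
  rw [← gauge_le_one_iff_mem hA hAc h0, gauge_smul_of_nonneg (inv_nonneg.2 hg.le), smul_eq_mul,
    inv_mul_cancel₀ hg.ne']

theorem le_gauge_of_mem_facetNormals {A : Set E} (hA : IsPolytope A) (h0 : (0 : E) ∈ interior A)
    {v : Module.Dual ℝ E} (hv : v ∈ facetNormals A) (x : E) : v x ≤ gauge A x := by
  by_cases hx : x = 0
  · simp [hx]
  have hg := gauge_pos_of_ne_zero hA.isCompact h0 hx
  have hm := inv_gauge_smul_mem hA.convex hA.isCompact h0 hx
  obtain ⟨y, hy⟩ := (hA.face v).nonempty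
  have := hy.2 _ hm
  rw [hv.2 y hy, map_smul, smul_eq_mul, inv_mul_le_iff₀ hg, mul_one] at this
  exact this

theorem exists_support_functional {A : Set E} (hA : Convex ℝ A) (hAc : IsCompact A)
    (h0 : (0 : E) ∈ interior A) {x : E} (hx : x ≠ 0) :
    ∃ v : Module.Dual ℝ E, v ≠ 0 ∧ (gauge A x)⁻¹ • x ∈ maxFace A v ∧
      v ((gauge A x)⁻¹ • x) = 1 := by
  have hg := gauge_pos_of_ne_zero hAc h0 hx
  set y := (gauge A x)⁻¹ • x with hy
  have hyA : y ∈ A := inv_gauge_smul_mem hA hAc h0 hx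
  have hyi : y ∉ interior A := fun h => by
    have := interior_subset_gauge_lt_one A h
    have this : gauge A y < 1 := this
    rw [hy, gauge_smul_of_nonneg (inv_nonneg.2 hg.le), smul_eq_mul, inv_mul_cancel₀ hg.ne'] at this
    exact lt_irrefl _ this
  obtain ⟨f, hf⟩ := geometric_hahn_banach_open_point hA.interior isOpen_interior hyi
  have hf0 : 0 < f y := by simpa using hf 0 h0
  have hle : ∀ a ∈ A, f a ≤ f y := fun a ha => by
    have ha' : a ∈ closure (interior A) := by
      rw [hA.closure_interior_eq_closure_of_nonempty_interior ⟨0, h0⟩]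
      exact subset_closure ha
    exact closure_minimal (fun b hb => (hf b hb).le) (isClosed_le f.continuous continuous_const) ha'
  refine ⟨(f y)⁻¹ • (f : E →ₗ[ℝ] ℝ), fun h => ?_, ⟨hyA, fun a ha => ?_⟩, ?_⟩
  · have := LinearMap.congr_fun h y
    simp [hf0.ne'] at this
  · change (f y)⁻¹ * f a ≤ (f y)⁻¹ * f y
    exact mul_le_mul_of_nonneg_left (hle a ha) (inv_nonneg.2 hf0.le)
  · simp [hf0.ne']

/-- A description without the gauge, so that a linear map carrying one facet to another visibly
carries cone to cone. -/
theorem facetCone_eq {A : Set E} (hA : IsPolytope A) (h0 : (0 : E) ∈ interior A)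
    {v : Module.Dual ℝ E} (hv : v ∈ facetNormals A) :
    facetCone A v = {x | ∃ r ∈ Icc (0 : ℝ) 1, ∃ y ∈ maxFace A v, x = r • y} := by
  have h0A : (0 : E) ∈ A := interior_subset h0
  ext x
  constructor
  · rintro ⟨hxA, hx⟩
    by_cases hx0 : x = 0
    · obtain ⟨y, hy⟩ := (hA.face v).nonempty
      exact ⟨0, by simp, y, hy, by simp [hx0]⟩
    have hg := gauge_pos_of_ne_zero hA.isCompact h0 hx0
    have hm := inv_gauge_smul_mem hA.convex hA.isCompact h0 hx0
    refine ⟨gauge A x, ⟨hg.le, (gauge_le_one_iff_mem hA.convex hA.isCompact h0 x).2 hxA⟩,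
      (gauge A x)⁻¹ • x, ?_, by rw [smul_smul, mul_inv_cancel₀ hg.ne', one_smul]⟩
    obtain ⟨y, hy⟩ := (hA.face v).nonempty
    refine mem_maxFace_of_apply_eq hy hm ?_
    rw [hv.2 y hy, map_smul, smul_eq_mul, inv_mul_eq_one₀ hg.ne']
    exact le_antisymm hx (le_gauge_of_mem_facetNormals hA h0 hv x)
  · rintro ⟨r, ⟨hr0, hr1⟩, y, hy, rfl⟩
    refine ⟨?_, ?_⟩
    · exact hA.convex.starConvex h0A |>.smul_mem hy.1 hr0 hr1
    · rw [gauge_smul_of_nonneg hr0, map_smul, hv.2 y hy, smul_eq_mul, smul_eq_mul]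
      exact mul_le_mul_of_nonneg_left (gauge_le_one_of_mem hy.1) hr0

variable [FiniteDimensional ℝ E]

theorem IsFacetFunctional.ker_eq {A : Set E} {v : Module.Dual ℝ E} (h : IsFacetFunctional A v)
    (hv : v ≠ 0) : vectorSpan ℝ (maxFace A v) = LinearMap.ker v := by
  refine Submodule.eq_of_le_of_finrank_eq (vectorSpan_maxFace_le_ker A v) ?_
  have := Module.Dual.finrank_ker_add_one_of_ne_zero hv
  unfold IsFacetFunctional at h
  omega

/-- A facet determines its normal: it fixes the kernel, and the value 1 on the facet fixes the
scale. There are finitely many faces. -/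
theorem IsPolytope.finite_facetNormals {A : Set E} (hA : IsPolytope A) :
    (facetNormals A).Finite := by
  refine Finite.of_finite_image (f := fun v => maxFace A v)
    (hA.finite_range_maxFace.subset (image_subset_range _ _)) ?_
  intro v hv w hw hvw
  simp only at hvw
  have hker : LinearMap.ker v = LinearMap.ker w := by
    rw [← hv.1.ker_eq (hA.ne_zero_of_mem_facetNormals hv),
      ← hw.1.ker_eq (hA.ne_zero_of_mem_facetNormals hw), hvw]
  obtain ⟨y, hy⟩ := (hA.face v).nonempty
  have h1 := hv.2 y hy
  have h2 := hw.2 y (hvw ▸ hy)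
  ext x
  have h3 : x - v x • y ∈ LinearMap.ker v := by simp [h1]
  rw [hker] at h3
  simp [h2, sub_eq_zero] at h3
  exact h3.symm

theorem finrank_span_le_finrank_vectorSpan_add_one (X : Set E) :
    Module.finrank ℝ (Submodule.span ℝ X) ≤ Module.finrank ℝ (vectorSpan ℝ X) + 1 := by
  rcases X.eq_empty_or_nonempty with rfl | ⟨y, hy⟩
  · rw [Submodule.span_empty, finrank_bot]
    exact Nat.zero_le _
  have hle : Submodule.span ℝ X ≤ vectorSpan ℝ X ⊔ Submodule.span ℝ {y} := by
    rw [Submodule.span_le]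
    intro x hx
    rw [SetLike.mem_coe, ← sub_add_cancel x y]
    exact Submodule.add_mem_sup (vsub_mem_vectorSpan ℝ hx hy) (Submodule.mem_span_singleton_self y)
  calc _ ≤ Module.finrank ℝ (vectorSpan ℝ X ⊔ Submodule.span ℝ {y} : Submodule ℝ E) :=
        Submodule.finrank_mono hle
    _ ≤ Module.finrank ℝ (vectorSpan ℝ X) + Module.finrank ℝ (Submodule.span ℝ {y}) :=
        Submodule.finrank_add_le_finrank_add_finrank _ _
    _ ≤ _ := by
        gcongr
        exact (finrank_span_le_card ({y} : Set E)).trans (by simp)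

theorem isClosed_gauge_le {A : Set E} (hA : Convex ℝ A) (h0 : (0 : E) ∈ interior A)
    (v : Module.Dual ℝ E) : IsClosed {x | gauge A x ≤ v x} :=
  isClosed_le (continuous_gauge hA (mem_interior_iff_mem_nhds.1 h0))
    v.continuous_of_finiteDimensional

/-- A nonzero point outside every facet cone has its radial projection in a face whose linear span
is proper. Finitely many proper subspaces are null, while the uncovered set is open, hence empty. -/
theorem exists_facetNormal_gauge_le [Nontrivial E] {A : Set E} (hA : IsPolytope A)
    (h0 : (0 : E) ∈ interior A) (x : E) : ∃ v ∈ facetNormals A, gauge A x ≤ v x := by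
  let _ : MeasurableSpace E := borel E
  have : BorelSpace E := ⟨rfl⟩
  let μ : Measure E := Measure.addHaar
  set S := ⋃ v ∈ facetNormals A, {x | gauge A x ≤ v x} with hS
  have hSc : IsClosed S := hA.finite_facetNormals.isClosed_biUnion
    fun v _ => isClosed_gauge_le hA.convex h0 v
  set T : Set (Set E) := {F ∈ range fun f : Module.Dual ℝ E => maxFace A f |
    Submodule.span ℝ F ≠ ⊤} with hT
  have hTf : T.Finite := hA.finite_range_maxFace.subset fun F hF => hF.1
  have hsub : Sᶜ ⊆ {0} ∪ ⋃ F ∈ T, (Submodule.span ℝ F : Set E) := by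
    intro x hx
    by_cases hx0 : x = 0
    · exact Or.inl hx0
    right
    have hg := gauge_pos_of_ne_zero hA.isCompact h0 hx0
    obtain ⟨v, hv0, hv, hv1⟩ := exists_support_functional hA.convex hA.isCompact h0 hx0
    have hxy : gauge A x • (gauge A x)⁻¹ • x = x := by rw [smul_smul, mul_inv_cancel₀ hg.ne', one_smul]
    rw [mem_iUnion₂]
    refine ⟨maxFace A v, ⟨⟨v, rfl⟩, fun htop => hx ?_⟩, ?_⟩
    · rw [hS, mem_iUnion₂]
      refine ⟨v, ⟨?_, fun y hy => (apply_eq_of_mem_maxFace hy hv).trans hv1⟩, ?_⟩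
      · have h1 := finrank_span_le_finrank_vectorSpan_add_one (maxFace A v)
        rw [htop, finrank_top] at h1
        have h2 := Submodule.finrank_mono (vectorSpan_maxFace_le_ker A v)
        have h3 := Module.Dual.finrank_ker_add_one_of_ne_zero hv0
        unfold IsFacetFunctional
        omega
      · simp only [mem_ofPred_eq]
        rw [map_smul, smul_eq_mul, inv_mul_eq_one₀ hg.ne'] at hv1
        exact hv1.le
    · rw [SetLike.mem_coe, ← hxy]
      exact Submodule.smul_mem _ _ (Submodule.subset_span hv)
  have hnull : μ Sᶜ = 0 := by
    refine measure_mono_null hsub (measure_union_null (measure_singleton 0) ?_)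
    exact (measure_biUnion_null_iff hTf.countable).2
      fun F hF => Measure.addHaar_submodule μ _ hF.2
  have hemp := (hSc.isOpen_compl.measure_eq_zero_iff μ).1 hnull
  have hx : x ∈ S := by
    by_contra h
    have : x ∈ Sᶜ := h
    rw [hemp] at this
    exact this
  simpa [hS] using hx

theorem isCompact_facetCone {A : Set E} (hA : IsPolytope A) (h0 : (0 : E) ∈ interior A)
    (v : Module.Dual ℝ E) : IsCompact (facetCone A v) :=
  hA.isCompact.inter_right (isClosed_gauge_le hA.convex h0 v)

variable [MeasurableSpace E] [BorelSpace E] (μ : Measure E) [μ.IsAddHaarMeasure]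

theorem measureReal_eq_sum_facetCone [Nontrivial E] {A : Set E} (hA : IsPolytope A)
    (h0 : (0 : E) ∈ interior A) :
    μ.real A = ∑ v ∈ hA.finite_facetNormals.toFinset, μ.real (facetCone A v) := by
  have hU : A = ⋃ v ∈ hA.finite_facetNormals.toFinset, facetCone A v := by
    ext x
    simp only [Finite.mem_toFinset, mem_iUnion, exists_prop]
    constructor
    · intro hx
      obtain ⟨v, hv, hvx⟩ := exists_facetNormal_gauge_le hA h0 x
      exact ⟨v, hv, hx, hvx⟩
    · rintro ⟨v, -, hx, -⟩
      exact hx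
  conv_lhs => rw [hU]
  rw [measureReal_def, measure_biUnion_finset₀, ENNReal.toReal_sum]
  · rfl
  · exact fun v _ => (isCompact_facetCone hA h0 v).measure_ne_top
  · intro v hv w hw hvw
    simp only [Finite.coe_toFinset] at hv hw
    -- On the overlap of two cones both normals equal the gauge, so the overlap lies in the null
    -- hyperplane ker (v - w).
    have hne : v - w ≠ 0 := sub_ne_zero.2 hvw
    refine measure_mono_null ?_ (Measure.addHaar_submodule μ (LinearMap.ker (v - w))
      (by rwa [Ne, LinearMap.ker_eq_top]))
    rintro x ⟨⟨_, hx1⟩, ⟨_, hx2⟩⟩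
    have h1 := le_gauge_of_mem_facetNormals hA h0 hv x
    have h2 := le_gauge_of_mem_facetNormals hA h0 hw x
    simp only [SetLike.mem_coe, LinearMap.mem_ker, LinearMap.sub_apply]
    linarith
  · exact fun v _ => (isCompact_facetCone hA h0 v).measurableSet.nullMeasurableSet

/-- If `C` satisfies the facet inequalities relaxed to v ≤ k v, it is covered by the facet cones of
`A` dilated by the factors k v. -/
theorem measureReal_le_sum_of_le [Nontrivial E] {A C : Set E} (hA : IsPolytope A)
    (h0 : (0 : E) ∈ interior A) {k : Module.Dual ℝ E → ℝ} (hk0 : ∀ v ∈ facetNormals A, 0 < k v)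
    (hk : ∀ v ∈ facetNormals A, ∀ x ∈ C, v x ≤ k v) :
    μ.real C ≤ ∑ v ∈ hA.finite_facetNormals.toFinset,
      k v ^ Module.finrank ℝ E * μ.real (facetCone A v) := by
  have hsub : C ⊆ ⋃ v ∈ hA.finite_facetNormals.toFinset, k v • facetCone A v := by
    intro x hx
    obtain ⟨v, hv, hvx⟩ := exists_facetNormal_gauge_le hA h0 x
    simp only [Finite.mem_toFinset, mem_iUnion, exists_prop]
    have hkv := hk0 v hv
    refine ⟨v, hv, (k v)⁻¹ • x, ⟨?_, ?_⟩, by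
      simp only [smul_smul, mul_inv_cancel₀ hkv.ne', one_smul]⟩
    · rw [← gauge_le_one_iff_mem hA.convex hA.isCompact h0,
        gauge_smul_of_nonneg (inv_nonneg.2 hkv.le), smul_eq_mul, inv_mul_le_iff₀ hkv, mul_one]
      exact hvx.trans (hk v hv x hx)
    · rw [gauge_smul_of_nonneg (inv_nonneg.2 hkv.le), map_smul, smul_eq_mul, smul_eq_mul]
      exact mul_le_mul_of_nonneg_left hvx (inv_nonneg.2 hkv.le)
  have hcomp : ∀ v, IsCompact (k v • facetCone A v) := fun v => (isCompact_facetCone hA h0 v).smul _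
  calc μ.real C ≤ μ.real (⋃ v ∈ hA.finite_facetNormals.toFinset, k v • facetCone A v) :=
        measureReal_mono hsub (hA.finite_facetNormals.toFinset.isCompact_biUnion
          fun v _ => hcomp v).measure_ne_top
    _ ≤ ∑ v ∈ hA.finite_facetNormals.toFinset, μ.real (k v • facetCone A v) :=
        measureReal_biUnion_finset_le _ _
    _ = _ := by
        refine Finset.sum_congr rfl fun v hv => ?_
        rw [Finite.mem_toFinset] at hv
        rw [measureReal_def, Measure.addHaar_smul, ENNReal.toReal_mul,
          ENNReal.toReal_ofReal (abs_nonneg _), abs_of_nonneg (pow_nonneg (hk0 v hv).le _),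
          measureReal_def]

end Cover

/-! ### Minkowski's first inequality and uniqueness theorem -/

section Minkowski

variable {E : Type*} [NormedAddCommGroup E] [NormedSpace ℝ E] [FiniteDimensional ℝ E]
  [MeasurableSpace E] [BorelSpace E] (μ : Measure E) [μ.IsAddHaarMeasure]

/-- Dyadic weights suffice and follow from the midpoint inequality: the midpoint of a point of A and
a point of (1 - t)A + tK lies in (1 - t/2)A + (t/2)K. -/
theorem measure_le_measure_convexCombination {A K : Set E}
    (hAx : Convex ℝ A) (hA : IsCompact A) (hK : IsCompact K)
    (hAK : μ K = μ A) (hA0 : 0 < μ A) (j : ℕ) :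
    μ A ≤ μ ((fun p : E × E => (1 - (2⁻¹ : ℝ) ^ j) • p.1 + ((2⁻¹ : ℝ) ^ j) • p.2) '' (A ×ˢ K)) := by
  have hc : ∀ j : ℕ, IsCompact
      ((fun p : E × E => (1 - (2⁻¹ : ℝ) ^ j) • p.1 + ((2⁻¹ : ℝ) ^ j) • p.2) '' (A ×ˢ K)) :=
    fun j => (hA.prod hK).image (by fun_prop)
  induction j with
  | zero =>
    obtain ⟨a, ha⟩ := nonempty_of_measure_ne_zero hA0.ne'
    rw [← hAK]
    refine measure_mono fun x hx => ⟨(a, x), ⟨ha, hx⟩, by simp⟩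
  | succ j ih =>
    have hBM := measure_mul_measure_le_sq_of_midpoint μ hA.measurableSet (hc j).measurableSet
      (hc (j + 1)).measurableSet ?_
    · have h1 : μ A * μ A ≤ _ := (mul_le_mul_right ih (μ A)).trans hBM
      rw [← sq] at h1
      exact (ENNReal.pow_le_pow_left_iff two_ne_zero).1 h1
    · rintro x hx _ ⟨⟨a, k⟩, ⟨ha, hk⟩, rfl⟩
      set t : ℝ := (2⁻¹ : ℝ) ^ j with ht
      have ht0 : 0 < t := by positivity
      have ht1 : t ≤ 1 := pow_le_one₀ (by norm_num) (by norm_num)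
      have hd : 0 < 1 - 2⁻¹ * t := by linarith
      -- The two points of `A` have weights 1/2 and (1 - t)/2, which sum to 1 - t/2; normalising
      -- merges them into one point of `A`.
      refine ⟨((2⁻¹ / (1 - 2⁻¹ * t)) • x + ((2⁻¹ * (1 - t)) / (1 - 2⁻¹ * t)) • a, k), ⟨?_, hk⟩, ?_⟩
      · refine hAx hx ha (by positivity) ?_ ?_
        · exact div_nonneg (by linarith) hd.le
        · rw [← add_div, div_eq_one_iff_eq hd.ne']
          ring
      · simp only
        rw [pow_succ', ← ht, smul_add, smul_smul, smul_smul, mul_div_cancel₀ _ hd.ne',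
          mul_div_cancel₀ _ hd.ne', smul_add, smul_add, smul_smul, smul_smul, add_assoc]

/-- Minkowski's first inequality. For t = 2^{-(j+1)}, Brunn–Minkowski and the cone cover give φ(0) =
vol A ≤ vol((1 - t)A + tK) ≤ φ(t), so φ'(0) ≥ 0, which is the claim up to the factor m. -/
theorem sum_facetCone_le_of_measure_eq [Nontrivial E] {A K : Set E} (hA : IsPolytope A)
    (h0 : (0 : E) ∈ interior A) (hK : IsCompact K) (hK0 : (0 : E) ∈ K) (hAK : μ K = μ A)
    {k : Module.Dual ℝ E → ℝ} (hk : ∀ v ∈ facetNormals A, ∀ x ∈ K, v x ≤ k v) :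
    ∑ v ∈ hA.finite_facetNormals.toFinset, μ.real (facetCone A v) ≤
      ∑ v ∈ hA.finite_facetNormals.toFinset, μ.real (facetCone A v) * k v := by
  have hpos : 0 < μ A := Measure.measure_pos_of_nonempty_interior μ ⟨0, h0⟩
  set s := hA.finite_facetNormals.toFinset with hs
  set m := Module.finrank ℝ E with hm
  set φ : ℝ → ℝ := fun t => ∑ v ∈ s, (1 + t * (k v - 1)) ^ m * μ.real (facetCone A v) with hφ
  have hφ0 : φ 0 = μ.real A := by
    rw [measureReal_eq_sum_facetCone μ hA h0]
    simp [hφ, hs]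
  have hk0 : ∀ v ∈ facetNormals A, 0 ≤ k v := fun v hv => by simpa using hk v hv 0 hK0
  -- The exponent j + 1 keeps t < 1, so the dilation factors 1 + t(k v - 1) are positive even if k v
  -- = 0.
  have hle : ∀ j : ℕ, φ 0 ≤ φ ((2⁻¹ : ℝ) ^ (j + 1)) := fun j => by
    set t : ℝ := (2⁻¹ : ℝ) ^ (j + 1) with ht
    have ht0 : 0 < t := by positivity
    have ht1 : t < 1 := pow_lt_one₀ (by norm_num) (by norm_num) (by omega)
    have h1 := measure_le_measure_convexCombination μ hA.convex hA.isCompact hK hAK hpos (j + 1)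
    rw [← ht] at h1
    have h2 : IsCompact ((fun p : E × E => (1 - t) • p.1 + t • p.2) '' (A ×ˢ K)) :=
      (hA.isCompact.prod hK).image (by fun_prop)
    rw [hφ0]
    refine (ENNReal.toReal_mono h2.measure_ne_top h1).trans ?_
    refine measureReal_le_sum_of_le μ hA h0 (k := fun v => 1 + t * (k v - 1)) (fun v hv => ?_)
      fun v hv => ?_
    · nlinarith [hk0 v hv]
    · rintro _ ⟨⟨a, b⟩, ⟨ha, hb⟩, rfl⟩
      have e1 : v a ≤ 1 := (le_gauge_of_mem_facetNormals hA h0 hv a).trans (gauge_le_one_of_mem ha)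
      have e2 := hk v hv b hb
      simp only [map_add, map_smul, smul_eq_mul]
      nlinarith
  have hder : HasDerivAt φ (∑ v ∈ s, (m * (k v - 1)) * μ.real (facetCone A v)) 0 := by
    refine HasDerivAt.fun_sum fun v _ => HasDerivAt.mul_const ?_ _
    have h1 : HasDerivAt (fun t : ℝ => 1 + t * (k v - 1)) (k v - 1) 0 := by
      simpa using ((hasDerivAt_id (0 : ℝ)).mul_const (k v - 1)).const_add 1
    simpa using h1.fun_pow m
  have hnonneg : 0 ≤ ∑ v ∈ s, (m * (k v - 1)) * μ.real (facetCone A v) := by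
    have htend : Filter.Tendsto (fun j : ℕ => (2⁻¹ : ℝ) ^ (j + 1)) Filter.atTop (𝓝[≠] 0) := by
      refine tendsto_nhdsWithin_iff.2 ⟨?_, .of_forall fun j => by simp⟩
      exact (tendsto_pow_atTop_nhds_zero_of_lt_one (by norm_num) (by norm_num)).comp
        (Filter.tendsto_add_atTop_nat 1)
    refine ge_of_tendsto' (hder.tendsto_slope.comp htend) fun j => ?_
    simp only [Function.comp, slope_def_field, sub_zero]
    exact div_nonneg (sub_nonneg.2 (hle j)) (by positivity)
  have hm0 : (0 : ℝ) < m := by exact_mod_cast Module.finrank_pos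
  have heq : ∑ v ∈ s, (m * (k v - 1)) * μ.real (facetCone A v) =
      m * (∑ v ∈ s, μ.real (facetCone A v) * k v - ∑ v ∈ s, μ.real (facetCone A v)) := by
    rw [← Finset.sum_sub_distrib, Finset.mul_sum]
    exact Finset.sum_congr rfl fun v _ => by ring
  rw [heq] at hnonneg
  exact sub_nonneg.1 (nonneg_of_mul_nonneg_right hnonneg hm0)

/-- The maximum of the functional `v` on `B`. -/
noncomputable def maxValue (B : Set E) (v : Module.Dual ℝ E) : ℝ := sSup (v '' B)

omit [FiniteDimensional ℝ E] [MeasurableSpace E] [BorelSpace E] in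
theorem maxValue_eq_of_mem_maxFace {B : Set E} {v : Module.Dual ℝ E} {y : E}
    (hy : y ∈ maxFace B v) : maxValue B v = v y :=
  IsGreatest.csSup_eq ⟨mem_image_of_mem v hy.1, by rintro _ ⟨z, hz, rfl⟩; exact hy.2 z hz⟩

omit [FiniteDimensional ℝ E] [MeasurableSpace E] [BorelSpace E] in
theorem IsPolytope.le_maxValue {B : Set E} (hB : IsPolytope B) (v : Module.Dual ℝ E) {y : E}
    (hy : y ∈ B) : v y ≤ maxValue B v := by
  obtain ⟨z, hz⟩ := (hB.face v).nonempty
  rw [maxValue_eq_of_mem_maxFace hz]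
  exact hz.2 y hy

omit [FiniteDimensional ℝ E] [MeasurableSpace E] [BorelSpace E] in
theorem IsPolytope.maxValue_smul {B : Set E} (hB : IsPolytope B) (v : Module.Dual ℝ E) {c : ℝ}
    (hc : 0 < c) : maxValue B (c • v) = c * maxValue B v := by
  obtain ⟨z, hz⟩ := (hB.face v).nonempty
  have hz' : z ∈ maxFace B (c • v) := by rwa [maxFace_smul B v hc]
  rw [maxValue_eq_of_mem_maxFace hz, maxValue_eq_of_mem_maxFace hz']
  rfl

omit [FiniteDimensional ℝ E] [MeasurableSpace E] [BorelSpace E] in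
theorem IsPolytope.maxValue_pos {B : Set E} (hB : IsPolytope B) (h0 : (0 : E) ∈ interior B)
    {v : Module.Dual ℝ E} (hv : v ≠ 0) : 0 < maxValue B v := by
  obtain ⟨x, hx⟩ : ∃ x, v x ≠ 0 := by
    by_contra! h
    exact hv (LinearMap.ext h)
  have key : ∀ x, 0 < v x → 0 < maxValue B v := fun x hx => by
    have hx0 : x ≠ 0 := by rintro rfl; simp at hx
    refine lt_of_lt_of_le ?_ (hB.le_maxValue v (inv_gauge_smul_mem hB.convex hB.isCompact h0 hx0))
    rw [map_smul, smul_eq_mul]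
    exact mul_pos (inv_pos.2 (gauge_pos_of_ne_zero hB.isCompact h0 hx0)) hx
  rcases lt_or_gt_of_ne hx with h | h
  · exact key (-x) (by simpa using h)
  · exact key x h

omit [FiniteDimensional ℝ E] [MeasurableSpace E] [BorelSpace E] in
theorem IsFacetFunctional.smul {A : Set E} {v : Module.Dual ℝ E} (h : IsFacetFunctional A v)
    {c : ℝ} (hc : 0 < c) : IsFacetFunctional A (c • v) := by
  unfold IsFacetFunctional
  rwa [maxFace_smul A v hc]

omit [FiniteDimensional ℝ E] [MeasurableSpace E] [BorelSpace E] in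
theorem inv_maxValue_smul_mem_facetNormals {B : Set E} {v : Module.Dual ℝ E}
    (h : IsFacetFunctional B v) (hr : 0 < maxValue B v) :
    (maxValue B v)⁻¹ • v ∈ facetNormals B := by
  refine ⟨h.smul (inv_pos.2 hr), fun x hx => ?_⟩
  rw [maxFace_smul B v (inv_pos.2 hr)] at hx
  rw [LinearMap.smul_apply, ← maxValue_eq_of_mem_maxFace hx, smul_eq_mul, inv_mul_cancel₀ hr.ne']

/-- On the hyperplane v = 1 the translation by t agrees with the transvection x ↦ x + v(x) t, of
determinant 1 + v(t), which is max_B v. The reflected case composes the transvection for -t with -1.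
-/
theorem measureReal_facetCone_of_isSignedTranslate {A B : Set E} (hA : IsPolytope A)
    (hB : IsPolytope B) (hA0 : (0 : E) ∈ interior A) (hB0 : (0 : E) ∈ interior B)
    {v : Module.Dual ℝ E} (hv : v ∈ facetNormals A)
    (h : IsSignedTranslate (maxFace A v) (maxFace B v)) :
    μ.real (facetCone B ((maxValue B v)⁻¹ • v)) = μ.real (facetCone A v) * maxValue B v := by
  have hv0 := hA.ne_zero_of_mem_facetNormals hv
  have hr := hB.maxValue_pos hB0 hv0
  have hvB : IsFacetFunctional B v := by
    unfold IsFacetFunctional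
    rw [h.vectorSpan_eq]
    exact hv.1
  have hw := inv_maxValue_smul_mem_facetNormals hvB hr
  obtain ⟨x₀, hx₀⟩ := (hA.face v).nonempty
  have main : ∀ L : E →ₗ[ℝ] E, L '' maxFace A v = maxFace B v → |L.det| = maxValue B v →
      μ.real (facetCone B ((maxValue B v)⁻¹ • v)) = μ.real (facetCone A v) * maxValue B v := by
    intro L hL hdet
    have himg : facetCone B ((maxValue B v)⁻¹ • v) = L '' facetCone A v := by
      rw [facetCone_eq hB hB0 hw, facetCone_eq hA hA0 hv, maxFace_smul B v (inv_pos.2 hr), ← hL]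
      ext x
      constructor
      · rintro ⟨ρ, hρ, _, ⟨y, hy, rfl⟩, rfl⟩
        exact ⟨ρ • y, ⟨ρ, hρ, y, hy, rfl⟩, map_smul _ _ _⟩
      · rintro ⟨_, ⟨ρ, hρ, y, hy, rfl⟩, rfl⟩
        exact ⟨ρ, hρ, L y, mem_image_of_mem L hy, map_smul _ _ _⟩
    rw [himg, measureReal_def, Measure.addHaar_image_linearMap, hdet, ENNReal.toReal_mul,
      ENNReal.toReal_ofReal hr.le, mul_comm, measureReal_def]
  obtain ⟨t, ht | ht⟩ := h
  · have hxB : t + x₀ ∈ maxFace B v := by rw [ht]; exact mem_image_of_mem _ hx₀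
    have hval := maxValue_eq_of_mem_maxFace hxB
    rw [map_add, hv.2 x₀ hx₀] at hval
    refine main (LinearMap.transvection v t) ?_ ?_
    · rw [ht]
      refine image_congr fun x hx => ?_
      rw [LinearMap.transvection.apply, hv.2 x hx, one_smul, add_comm]
    · rw [LinearMap.transvection.det, add_comm, ← hval, abs_of_pos hr]
  · have hxB : t - x₀ ∈ maxFace B v := by rw [ht]; exact mem_image_of_mem _ hx₀
    have hval := maxValue_eq_of_mem_maxFace hxB
    rw [map_sub, hv.2 x₀ hx₀] at hval
    refine main ((-1 : ℝ) • LinearMap.transvection v (-t)) ?_ ?_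
    · rw [ht]
      refine image_congr fun x hx => ?_
      rw [LinearMap.smul_apply, LinearMap.transvection.apply, hv.2 x hx, one_smul]
      module
    · rw [LinearMap.det_smul, LinearMap.transvection.det, map_neg, abs_mul, abs_pow, abs_neg,
        abs_one, one_pow, one_mul, ← abs_neg, hval]
      rw [hval] at hr
      rw [abs_of_pos] <;> linarith

theorem measureReal_eq_sum_mul_maxValue [Nontrivial E] {A B : Set E} (hA : IsPolytope A)
    (hB : IsPolytope B) (hA0 : (0 : E) ∈ interior A) (hB0 : (0 : E) ∈ interior B)
    (h : ∀ v, IsFacetFunctional A v ∨ IsFacetFunctional B v →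
      IsSignedTranslate (maxFace A v) (maxFace B v)) :
    μ.real B = ∑ v ∈ hA.finite_facetNormals.toFinset, μ.real (facetCone A v) * maxValue B v := by
  have hAB : ∀ v, IsFacetFunctional A v ↔ IsFacetFunctional B v := fun v => by
    constructor <;> intro hv
    · have := (h v (Or.inl hv)).vectorSpan_eq
      unfold IsFacetFunctional at *
      rwa [this]
    · have := (h v (Or.inr hv)).vectorSpan_eq
      unfold IsFacetFunctional at *
      rwa [← this]
  have hone : ∀ {C : Set E} (_ : IsPolytope C) {v : Module.Dual ℝ E}, v ∈ facetNormals C →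
      maxValue C v = 1 := fun hC v hv => by
    obtain ⟨x, hx⟩ := (hC.face v).nonempty
    rw [maxValue_eq_of_mem_maxFace hx, hv.2 x hx]
  rw [measureReal_eq_sum_facetCone μ hB hB0]
  symm
  refine Finset.sum_nbij' (fun v => (maxValue B v)⁻¹ • v) (fun w => (maxValue A w)⁻¹ • w)
    ?_ ?_ ?_ ?_ ?_
  · intro v hv
    rw [Finite.mem_toFinset] at *
    exact inv_maxValue_smul_mem_facetNormals ((hAB v).1 hv.1)
      (hB.maxValue_pos hB0 (hA.ne_zero_of_mem_facetNormals hv))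
  · intro v hv
    rw [Finite.mem_toFinset] at *
    exact inv_maxValue_smul_mem_facetNormals ((hAB v).2 hv.1)
      (hA.maxValue_pos hA0 (hB.ne_zero_of_mem_facetNormals hv))
  · intro v hv
    rw [Finite.mem_toFinset] at hv
    have hr := hB.maxValue_pos hB0 (hA.ne_zero_of_mem_facetNormals hv)
    rw [hA.maxValue_smul v (inv_pos.2 hr), hone hA hv, mul_one, inv_inv, smul_smul,
      mul_inv_cancel₀ hr.ne', one_smul]
  · intro v hv
    rw [Finite.mem_toFinset] at hv
    have hr := hA.maxValue_pos hA0 (hB.ne_zero_of_mem_facetNormals hv)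
    rw [hB.maxValue_smul v (inv_pos.2 hr), hone hB hv, mul_one, inv_inv, smul_smul,
      mul_inv_cancel₀ hr.ne', one_smul]
  · intro v hv
    rw [Finite.mem_toFinset] at hv
    exact (measureReal_facetCone_of_isSignedTranslate μ hA hB hA0 hB0 hv (h v (Or.inl hv.1))).symm

/-- A scaled copy of `K` has the same measure as `A`. -/
theorem exists_smul_measure_eq [Nontrivial E] {A K : Set E} (hA : IsCompact A) (hK : IsCompact K)
    (hA0 : 0 < μ A) (hK0 : 0 < μ K) :
    ∃ c : ℝ, 0 < c ∧ μ (c • K) = μ A ∧ c ^ Module.finrank ℝ E * μ.real K = μ.real A := by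
  have ha : 0 < μ.real A := ENNReal.toReal_pos hA0.ne' hA.measure_ne_top
  have hk : 0 < μ.real K := ENNReal.toReal_pos hK0.ne' hK.measure_ne_top
  have hm : Module.finrank ℝ E ≠ 0 := Module.finrank_pos.ne'
  set c := (μ.real A / μ.real K) ^ ((Module.finrank ℝ E : ℝ)⁻¹) with hc
  have hc0 : 0 < c := Real.rpow_pos_of_pos (div_pos ha hk) _
  have hcm : c ^ Module.finrank ℝ E * μ.real K = μ.real A := by
    rw [hc, Real.rpow_inv_natCast_pow (div_pos ha hk).le hm, div_mul_cancel₀ _ hk.ne']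
  refine ⟨c, hc0, ?_, hcm⟩
  rw [← ENNReal.toReal_eq_toReal_iff' (hK.smul c).measure_ne_top hA.measure_ne_top,
    Measure.addHaar_smul, ENNReal.toReal_mul, ENNReal.toReal_ofReal (abs_nonneg _),
    abs_of_nonneg (by positivity)]
  exact hcm

/-- Scale `B` by c to the volume of `A`. Minkowski's first inequality reads vol A ≤ c vol B while
vol A = c^m vol B, so c^m ≤ c; as m ≥ 2, c ≤ 1. In dimension 1 this would fail. -/
theorem measureReal_le_of_isSignedTranslate {A B : Set E} (hA : IsPolytope A)
    (hB : IsPolytope B) (hA0 : (0 : E) ∈ interior A) (hB0 : (0 : E) ∈ interior B)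
    (hdim : 2 ≤ Module.finrank ℝ E)
    (h : ∀ v, IsFacetFunctional A v ∨ IsFacetFunctional B v →
      IsSignedTranslate (maxFace A v) (maxFace B v)) : μ.real A ≤ μ.real B := by
  have : Nontrivial E := Module.nontrivial_of_finrank_pos (R := ℝ) (by omega)
  have hposA : 0 < μ A := Measure.measure_pos_of_nonempty_interior μ ⟨0, hA0⟩
  have hposB : 0 < μ B := Measure.measure_pos_of_nonempty_interior μ ⟨0, hB0⟩
  have hb : 0 < μ.real B := ENNReal.toReal_pos hposB.ne' hB.isCompact.measure_ne_top
  obtain ⟨c, hc0, hcA, hc⟩ := exists_smul_measure_eq μ hA.isCompact hB.isCompact hposA hposB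
  have h1 := sum_facetCone_le_of_measure_eq μ hA hA0 (hB.isCompact.smul c)
    ⟨0, interior_subset hB0, smul_zero c⟩ hcA (k := fun v => c * maxValue B v) (by
      rintro v hv _ ⟨x, hx, rfl⟩
      simp only [map_smul, smul_eq_mul]
      exact mul_le_mul_of_nonneg_left (hB.le_maxValue v hx) hc0.le)
  have h2 : ∑ v ∈ hA.finite_facetNormals.toFinset, μ.real (facetCone A v) * (c * maxValue B v) =
      c * μ.real B := by
    rw [measureReal_eq_sum_mul_maxValue μ hA hB hA0 hB0 h, Finset.mul_sum]
    exact Finset.sum_congr rfl fun v _ => by ring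
  rw [← measureReal_eq_sum_facetCone μ hA hA0, h2, ← hc] at h1
  have h3 : c ^ Module.finrank ℝ E ≤ c := le_of_mul_le_mul_right h1 hb
  have hc1 : c ≤ 1 := by
    by_contra! hlt
    have : c ^ 1 < c ^ Module.finrank ℝ E := pow_lt_pow_right₀ hlt (by omega)
    rw [pow_one] at this
    linarith
  rw [← hc]
  exact mul_le_of_le_one_left hb.le (pow_le_one₀ hc0.le hc1)

omit [MeasurableSpace E] [BorelSpace E] in
-- Volumes agree by the preceding inequality both ways. For C = (A + B)/2 scaled by c to the volume
-- of `A`, Minkowski's first inequality gives vol A ≤ c (vol A + vol B)/2 = c vol A, so c ≥ 1 and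
-- vol C ≤ vol A. Brunn–Minkowski gives the reverse.
theorem exists_translate_of_isSignedTranslate_aux {A B : Set E} (hA : IsPolytope A)
    (hB : IsPolytope B) (hA0 : (0 : E) ∈ interior A) (hB0 : (0 : E) ∈ interior B)
    (hdim : 2 ≤ Module.finrank ℝ E)
    (h : ∀ v, IsFacetFunctional A v ∨ IsFacetFunctional B v →
      IsSignedTranslate (maxFace A v) (maxFace B v)) : ∃ z, A = (fun x => z + x) '' B := by
  have : Nontrivial E := Module.nontrivial_of_finrank_pos (R := ℝ) (by omega)
  let _ : MeasurableSpace E := borel E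
  have : BorelSpace E := ⟨rfl⟩
  let μ : Measure E := Measure.addHaar
  have hposA : 0 < μ A := Measure.measure_pos_of_nonempty_interior μ ⟨0, hA0⟩
  have hAfin := hA.isCompact.measure_ne_top (μ := μ)
  have hBfin := hB.isCompact.measure_ne_top (μ := μ)
  have hab : μ.real B = μ.real A := le_antisymm
    (measureReal_le_of_isSignedTranslate μ hB hA hB0 hA0 hdim fun v hv => (h v hv.symm).symm)
    (measureReal_le_of_isSignedTranslate μ hA hB hA0 hB0 hdim h)
  have hab' : μ B = μ A := (ENNReal.toReal_eq_toReal_iff' hBfin hAfin).1 hab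
  set C := (fun p : E × E => (2⁻¹ : ℝ) • (p.1 + p.2)) '' (A ×ˢ B) with hC
  have hCc : IsCompact C := (hA.isCompact.prod hB.isCompact).image (by fun_prop)
  have hCx : Convex ℝ C := by
    rintro _ ⟨⟨a, b⟩, ⟨ha, hb⟩, rfl⟩ _ ⟨⟨a', b'⟩, ⟨ha', hb'⟩, rfl⟩ s t hs ht hst
    refine ⟨(s • a + t • a', s • b + t • b'), ⟨hA.convex ha ha' hs ht hst,
      hB.convex hb hb' hs ht hst⟩, ?_⟩
    simp only
    module
  have hABC : ∀ x ∈ A, ∀ y ∈ B, (2⁻¹ : ℝ) • (x + y) ∈ C := fun x hx y hy => ⟨(x, y), ⟨hx, hy⟩, rfl⟩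
  have hge : μ A ≤ μ C := by
    have := measure_mul_measure_le_sq_of_midpoint μ hA.isCompact.measurableSet
      hB.isCompact.measurableSet hCc.measurableSet hABC
    rw [hab', ← sq] at this
    exact (ENNReal.pow_le_pow_left_iff two_ne_zero).1 this
  have hc : 0 < μ.real C := ENNReal.toReal_pos (hposA.trans_le hge).ne' hCc.measure_ne_top
  have hle : μ.real C ≤ μ.real A := by
    obtain ⟨c, hc0, hcA, hcm⟩ := exists_smul_measure_eq μ hA.isCompact hCc hposA (hposA.trans_le hge)
    have h1 := sum_facetCone_le_of_measure_eq μ hA hA0 (hCc.smul c)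
      ⟨0, ⟨(0, 0), ⟨interior_subset hA0, interior_subset hB0⟩, by simp⟩, smul_zero c⟩ hcA
      (k := fun v => c * (2⁻¹ * (1 + maxValue B v))) (by
        rintro v hv _ ⟨_, ⟨⟨x, y⟩, ⟨hx, hy⟩, rfl⟩, rfl⟩
        simp only [map_smul, smul_eq_mul, map_add]
        have e1 := (le_gauge_of_mem_facetNormals hA hA0 hv x).trans (gauge_le_one_of_mem hx)
        have e2 := hB.le_maxValue v hy
        gcongr)
    have h2 : ∑ v ∈ hA.finite_facetNormals.toFinset,
        μ.real (facetCone A v) * (c * (2⁻¹ * (1 + maxValue B v))) =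
        c * (2⁻¹ * (μ.real A + μ.real B)) := by
      rw [measureReal_eq_sum_mul_maxValue μ hA hB hA0 hB0 h, measureReal_eq_sum_facetCone μ hA hA0,
        ← Finset.sum_add_distrib, Finset.mul_sum, Finset.mul_sum]
      exact Finset.sum_congr rfl fun v _ => by ring
    rw [← measureReal_eq_sum_facetCone μ hA hA0, h2, hab] at h1
    have ha : 0 < μ.real A := ENNReal.toReal_pos hposA.ne' hAfin
    have hc1 : 1 ≤ c := by
      by_contra! hlt
      nlinarith
    rw [← hcm]
    exact le_mul_of_one_le_left hc.le (one_le_pow₀ hc1)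
  have hCA : μ C = μ A := le_antisymm ((ENNReal.toReal_le_toReal hCc.measure_ne_top hAfin).1 hle) hge
  exact hA.convex.exists_translate_of_measure_midpoint_eq μ hA.isCompact hB.convex hB.isCompact
    hCx hCc hABC hposA hab' hCA

omit [NormedSpace ℝ E] [FiniteDimensional ℝ E] [MeasurableSpace E] [BorelSpace E] in
theorem zero_mem_interior_add_image {A : Set E} {a : E} (ha : a ∈ interior A) :
    (0 : E) ∈ interior ((fun x => -a + x) '' A) := by
  have h : (fun x => -a + x) '' interior A ⊆ interior ((fun x => -a + x) '' A) :=
    (isOpenMap_add_left (-a)).image_interior_subset A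
  exact h ⟨a, ha, by simp⟩

omit [MeasurableSpace E] [BorelSpace E] in
theorem IsPolytope.interior_nonempty {A : Set E} (hA : IsPolytope A) (h : vectorSpan ℝ A = ⊤) :
    (interior A).Nonempty := by
  rw [hA.convex.interior_nonempty_iff_affineSpan_eq_top]
  exact (AffineSubspace.affineSpan_eq_top_iff_vectorSpan_eq_top_of_nonempty ℝ E E hA.nonempty).2 h

omit [MeasurableSpace E] [BorelSpace E] in
/-- Minkowski's uniqueness theorem for full-dimensional polytopes whose corresponding facets are
translates of each other up to a point reflection. -/
theorem exists_translate_of_isSignedTranslate {A B : Set E} (hA : IsPolytope A)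
    (hB : IsPolytope B) (hA' : vectorSpan ℝ A = ⊤) (hB' : vectorSpan ℝ B = ⊤)
    (hdim : 2 ≤ Module.finrank ℝ E)
    (h : ∀ v, IsFacetFunctional A v ∨ IsFacetFunctional B v →
      IsSignedTranslate (maxFace A v) (maxFace B v)) : ∃ z, A = (fun x => z + x) '' B := by
  obtain ⟨a, ha⟩ := hA.interior_nonempty hA'
  obtain ⟨b, hb⟩ := hB.interior_nonempty hB'
  have hff : ∀ (C : Set E) (c : E) (v : Module.Dual ℝ E),
      IsFacetFunctional ((fun x => c + x) '' C) v ↔ IsFacetFunctional C v := fun C c v => by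
    unfold IsFacetFunctional
    rw [maxFace_add_image, vectorSpan_add_image]
  obtain ⟨z, hz⟩ := exists_translate_of_isSignedTranslate_aux (hA.add_image (-a))
    (hB.add_image (-b)) (zero_mem_interior_add_image ha) (zero_mem_interior_add_image hb) hdim
    fun v hv => by
      rw [hff, hff] at hv
      rw [maxFace_add_image, maxFace_add_image]
      exact (IsSignedTranslate.symm ⟨-a, Or.inl rfl⟩).trans ((h v hv).trans ⟨-b, Or.inl rfl⟩)
  refine ⟨a + (z + -b), ?_⟩
  have := congrArg (fun S => (fun x => a + x) '' S) hz
  simp only [image_image, add_neg_cancel_left, image_id'] at this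
  rw [this]
  refine image_congr fun x _ => by abel

end Minkowski

/-! ### Passing to coordinates in a linear subspace -/

section Chart

variable {E : Type*} [AddCommGroup E] [Module ℝ E] {W : Submodule ℝ E} {p q : E} {X Y : Set E}

/-- The set `X - p`, as a subset of the submodule `W`. -/
def submoduleChart (W : Submodule ℝ E) (p : E) (X : Set E) : Set W := {w | p + (w : E) ∈ X}

theorem mem_submoduleChart {w : W} : w ∈ submoduleChart W p X ↔ p + (w : E) ∈ X := Iff.rfl

theorem image_submoduleChart (h : ∀ x ∈ X, x - p ∈ W) :
    (fun w : W => p + (w : E)) '' submoduleChart W p X = X := by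
  ext x
  constructor
  · rintro ⟨w, hw, rfl⟩
    exact hw
  · intro hx
    exact ⟨⟨x - p, h x hx⟩, by simpa [mem_submoduleChart] using hx, by simp⟩

theorem map_vectorSpan_submoduleChart (h : ∀ x ∈ X, x - p ∈ W) :
    (vectorSpan ℝ (submoduleChart W p X)).map W.subtype = vectorSpan ℝ X := by
  have h1 := AffineMap.map_vectorSpan
    (AffineMap.const ℝ W p + W.subtype.toAffineMap) (s := submoduleChart W p X)
  have h2 : ⇑(AffineMap.const ℝ W p + W.subtype.toAffineMap) = fun w : W => p + (w : E) := by
    ext x; simp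
  have h3 : (AffineMap.const ℝ W p + W.subtype.toAffineMap).linear = W.subtype := by
    ext x; simp
  rw [h2, h3, image_submoduleChart h] at h1
  exact h1

theorem finrank_vectorSpan_submoduleChart (h : ∀ x ∈ X, x - p ∈ W) :
    Module.finrank ℝ (vectorSpan ℝ (submoduleChart W p X)) =
      Module.finrank ℝ (vectorSpan ℝ X) := by
  rw [← map_vectorSpan_submoduleChart h]
  exact (LinearEquiv.finrank_eq (Submodule.equivMapOfInjective _ W.injective_subtype _))

theorem maxFace_submoduleChart (h : ∀ x ∈ X, x - p ∈ W) (f : Module.Dual ℝ E) :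
    maxFace (submoduleChart W p X) (f ∘ₗ W.subtype) = submoduleChart W p (maxFace X f) := by
  ext w
  constructor
  · rintro ⟨hw, hm⟩
    refine ⟨hw, fun y hy => ?_⟩
    have := hm ⟨y - p, h y hy⟩ (by simpa [mem_submoduleChart] using hy)
    simp only [LinearMap.comp_apply, Submodule.subtype_apply, map_sub] at this
    rw [map_add]
    linarith
  · rintro ⟨hw, hm⟩
    refine ⟨hw, fun y hy => ?_⟩
    have := hm _ hy
    simp only [map_add] at this
    simp only [LinearMap.comp_apply, Submodule.subtype_apply]
    linarith

theorem IsPolytope.chart (hX : IsPolytope X) (h : ∀ x ∈ X, x - p ∈ W) :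
    IsPolytope (submoduleChart W p X) := by
  obtain ⟨V, hV, ⟨v, hv⟩, rfl⟩ := hX
  have hVc : ∀ x ∈ V, x - p ∈ W := fun x hx => h x (subset_convexHull ℝ V hx)
  have hinj : Function.Injective fun w : W => p + (w : E) := fun x y hxy => by
    simpa using hxy
  refine ⟨submoduleChart W p V, ?_, ⟨⟨v - p, hVc v hv⟩, ?_⟩, ?_⟩
  · exact hV.preimage hinj.injOn
  · simpa [mem_submoduleChart] using hv
  · apply hinj.image_injective
    have h1 := (AffineMap.const ℝ W p + W.subtype.toAffineMap).image_convexHull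
      (submoduleChart W p V)
    have h2 : ⇑(AffineMap.const ℝ W p + W.subtype.toAffineMap) =
        fun w : W => p + (w : E) := by
      ext x; simp
    rw [h2, image_submoduleChart hVc] at h1
    rw [h1, image_submoduleChart h]

theorem submoduleChart_eq_sub_image (hX : X.Nonempty) (h : ∀ x ∈ X, x - p ∈ W)
    (h' : ∀ y ∈ Y, y - q ∈ W) {t : E} (ht : Y = (fun x => t - x) '' X) :
    ∃ s, submoduleChart W q Y = (fun x => s - x) '' submoduleChart W p X := by
  obtain ⟨x₀, hx₀⟩ := hX
  have hs : t - p - q ∈ W := by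
    have h1 := add_mem (h' (t - x₀) (by rw [ht]; exact mem_image_of_mem _ hx₀)) (h x₀ hx₀)
    convert h1 using 1
    abel
  refine ⟨⟨_, hs⟩, ?_⟩
  ext w
  rw [mem_submoduleChart, ht]
  constructor
  · rintro ⟨x, hx, hxw⟩
    refine ⟨⟨x - p, h x hx⟩, by simpa [mem_submoduleChart] using hx, Subtype.ext ?_⟩
    have : (w : E) = t - x - q := by
      rw [← add_sub_cancel_left q (w : E), ← hxw]
    rw [this]
    simp only [AddSubgroupClass.coe_sub]
    abel
  · rintro ⟨x, hx, rfl⟩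
    refine ⟨p + x, hx, ?_⟩
    simp only [AddSubgroupClass.coe_sub]
    abel

theorem IsSignedTranslate.chart (hX : X.Nonempty) (h : ∀ x ∈ X, x - p ∈ W)
    (h' : ∀ y ∈ Y, y - q ∈ W) (hXY : IsSignedTranslate X Y) :
    IsSignedTranslate (submoduleChart W p X) (submoduleChart W q Y) := by
  obtain ⟨t, ht | ht⟩ := hXY
  · obtain ⟨x₀, hx₀⟩ := hX
    have hs : t + p - q ∈ W := by
      have h1 := sub_mem (h' (t + x₀) (by rw [ht]; exact mem_image_of_mem _ hx₀)) (h x₀ hx₀)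
      convert h1 using 1
      abel
    refine ⟨⟨_, hs⟩, Or.inl ?_⟩
    ext w
    rw [mem_submoduleChart, ht]
    constructor
    · rintro ⟨x, hx, hxw⟩
      refine ⟨⟨x - p, h x hx⟩, by simpa [mem_submoduleChart] using hx, Subtype.ext ?_⟩
      have : (w : E) = t + x - q := by
        rw [← add_sub_cancel_left q (w : E), ← hxw]
      rw [this]
      simp only [Submodule.coe_add]
      abel
    · rintro ⟨x, hx, rfl⟩
      refine ⟨p + x, hx, ?_⟩
      simp only [Submodule.coe_add]
      abel
  · obtain ⟨s, hs⟩ := submoduleChart_eq_sub_image hX h h' ht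
    exact ⟨s, Or.inr hs⟩

theorem IsPointSymmetric.of_submoduleChart (h : ∀ x ∈ X, x - p ∈ W)
    (hX : IsPointSymmetric (submoduleChart W p X)) : IsPointSymmetric X := by
  obtain ⟨t, ht⟩ := hX
  refine ⟨p + p + t, ?_⟩
  conv_lhs => rw [← image_submoduleChart h, ht, image_image]
  conv_rhs => rw [← image_submoduleChart h, image_image]
  refine image_congr fun x _ => ?_
  simp only [AddSubgroupClass.coe_sub]
  abel

theorem exists_extend_dual (g : Module.Dual ℝ W) : ∃ f : Module.Dual ℝ E, f ∘ₗ W.subtype = g :=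
  LinearMap.exists_extend g

end Chart

/-! ### The belt argument linking a facet to the opposite face -/

section Belt

variable {E : Type*} [AddCommGroup E] [Module ℝ E]

theorem finrank_vectorSpan_maxFace_lt [FiniteDimensional ℝ E] {X : Set E} {u : Module.Dual ℝ E}
    (h : ¬ ∀ x ∈ X, ∀ y ∈ X, u x = u y) :
    Module.finrank ℝ (vectorSpan ℝ (maxFace X u)) < Module.finrank ℝ (vectorSpan ℝ X) := by
  refine Submodule.finrank_lt_finrank_of_lt
    (lt_of_le_of_ne (vectorSpan_mono ℝ (maxFace_subset X u)) fun heq => h fun x hx y hy => ?_)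
  exact apply_eq_of_vectorSpan_le_ker (heq ▸ vectorSpan_maxFace_le_ker X u) hx hy

/-- A property of real numbers that holds near `+∞`, persists slightly to the left, and is closed
from the right holds everywhere. -/
theorem forall_of_eventually_of_step {G : ℝ → Prop} {S : ℝ} (hS : ∀ s > S, G s)
    (hstep : ∀ s, G s → ∀ᶠ ε : ℝ in 𝓝[>] 0, G (s - ε)) (hclosed : ∀ s, (∀ s' > s, G s') → G s)
    (s : ℝ) : G s := by
  by_contra hs
  set T : Set ℝ := {a | ∀ s' > a, G s'} with hT
  have hne : T.Nonempty := ⟨S, hS⟩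
  have hbdd : BddBelow T := ⟨s, fun a ha => by
    by_contra! hlt
    exact hs (ha s hlt)⟩
  have hgt : ∀ s' > sInf T, G s' := fun s' hs' => by
    obtain ⟨a, ha, has⟩ := exists_lt_of_csInf_lt hne hs'
    exact ha s' has
  have h0 := hclosed _ hgt
  obtain ⟨δ, hδ, hG⟩ := mem_nhdsGT_iff_exists_Ioo_subset.1 (hstep _ h0)
  rw [mem_Ioi] at hδ
  -- The property holds at the infimum and persists a distance δ to its left, which contradicts
  -- minimality.
  have hmem : sInf T - δ ∈ T := fun s' hs' => by
    rcases lt_trichotomy s' (sInf T) with h | h | h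
    · have : sInf T - s' ∈ Ioo 0 δ := ⟨by linarith, by linarith⟩
      simpa using hG this
    · rwa [h]
    · exact hgt s' h
  have := csInf_le hbdd hmem
  linarith

variable [FiniteDimensional ℝ E]

/-- If the facets of `P` are point symmetric, a codimension-two face of `P` in the facet with normal
`u` reappears, up to a translation and a point reflection, in the face with normal `-u`. -/
theorem IsPolytope.isSignedTranslate_maxFace_neg {P : Set E} (hP : IsPolytope P)
    (hsym : ∀ f : Module.Dual ℝ E,
      Module.finrank ℝ (vectorSpan ℝ (maxFace P f)) + 1 = Module.finrank ℝ E →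
      IsPointSymmetric (maxFace P f))
    {u v : Module.Dual ℝ E}
    (hu : Module.finrank ℝ (vectorSpan ℝ (maxFace P u)) + 1 = Module.finrank ℝ E)
    (hv : Module.finrank ℝ (vectorSpan ℝ (maxFace (maxFace P u) v)) + 2 = Module.finrank ℝ E) :
    IsSignedTranslate (maxFace (maxFace P u) v) (maxFace (maxFace P (-u)) v) := by
  set R := maxFace (maxFace P u) v with hR
  -- `G s` concerns the far end, where u is minimal, of the face met at parameter s.
  set G : ℝ → Prop := fun s => IsSignedTranslate R (maxFace (maxFace P (v + s • u)) (-u)) with hG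
  have hne : ∀ s : ℝ, v + s • u ≠ 0 := fun s hs => by
    have hself : maxFace (maxFace P u) v = maxFace P u := by
      refine maxFace_eq_self fun x hx y hy => ?_
      have h1 := LinearMap.congr_fun hs x
      have h2 := LinearMap.congr_fun hs y
      simp only [LinearMap.add_apply, LinearMap.smul_apply, LinearMap.zero_apply] at h1 h2
      rw [apply_eq_of_mem_maxFace hx hy] at h1
      linarith
    rw [hR, hself] at hv
    omega
  have hconst : ∀ {X : Set E}, (∀ x ∈ X, ∀ y ∈ X, u x = u y) → maxFace X (-u) = X :=
    fun h => maxFace_eq_self fun x hx y hy => by simp [h x hx y hy]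
  have hface : ∀ X : Set E, maxFace (maxFace X u) (-u) = maxFace X u :=
    fun X => hconst fun x hx y hy => apply_eq_of_mem_maxFace hx hy
  have hface' : ∀ X : Set E, maxFace (maxFace X (-u)) (-u) = maxFace X (-u) :=
    fun X => maxFace_eq_self fun x hx y hy => apply_eq_of_mem_maxFace hx hy
  -- Crossing one face of the belt. If u is constant on it, both ends are the whole face. Otherwise
  -- its dimension exceeds that of R, so it is a facet and its symmetry exchanges the two ends.
  have hflip : ∀ s, IsSignedTranslate R (maxFace (maxFace P (v + s • u)) u) → G s := fun s h => by
    set X := maxFace P (v + s • u) with hX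
    by_cases hc : ∀ x ∈ X, ∀ y ∈ X, u x = u y
    · have h1 : maxFace X u = X := maxFace_eq_self hc
      change IsSignedTranslate R (maxFace X (-u))
      rw [hconst hc]
      rwa [h1] at h
    · have h1 := finrank_vectorSpan_maxFace_lt hc
      rw [h.vectorSpan_eq] at h1
      have h2 := Submodule.finrank_mono (vectorSpan_maxFace_le_ker P (v + s • u))
      have h3 := Module.Dual.finrank_ker_add_one_of_ne_zero (hne s)
      obtain ⟨t, ht⟩ := hsym (v + s • u) (by rw [← hX] at h2 ⊢; omega)
      rw [← hX] at ht
      refine h.trans ⟨t, Or.inr ?_⟩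
      change maxFace X (-u) = _
      conv_lhs => rw [ht]
      rw [maxFace_sub_image, neg_neg]
  have hall : ∀ s, G s := by
    have h1 := tendsto_inv_atTop_nhdsGT_zero.eventually (hP.eventually_maxFace_add_smul u v)
    obtain ⟨S, hS⟩ := (h1.and (Filter.eventually_gt_atTop (0 : ℝ))).exists_forall_of_atTop
    -- For large s the face is R itself. Just left of s it is the far end of the face at s; just
    -- right of s it is the near end, which `hflip` carries across.
    refine forall_of_eventually_of_step (S := S) (fun s hs => ?_) (fun s hs => ?_) (fun s hs => ?_)
    · obtain ⟨h2, h3⟩ := hS s (le_of_lt hs)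
      have h4 : v + s • u = s • (u + s⁻¹ • v) := by
        rw [smul_add, smul_smul, mul_inv_cancel₀ h3.ne', one_smul, add_comm]
      change IsSignedTranslate R (maxFace (maxFace P (v + s • u)) (-u))
      rw [h4, maxFace_smul _ _ h3, h2, hconst fun x hx y hy => apply_eq_of_mem_maxFace hx.1 hy.1]
      exact IsSignedTranslate.refl _
    · filter_upwards [hP.eventually_maxFace_add_smul (v + s • u) (-u)] with ε hε
      have h4 : v + (s - ε) • u = v + s • u + ε • -u := by module
      change IsSignedTranslate R (maxFace (maxFace P (v + (s - ε) • u)) (-u))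
      rw [h4, hε, hface']
      exact hs
    · obtain ⟨ε, hε, hε0⟩ := ((hP.eventually_maxFace_add_smul (v + s • u) u).and
        self_mem_nhdsWithin).exists
      have h5 := hs (s + ε) (by linarith)
      have h4 : v + (s + ε) • u = v + s • u + ε • u := by module
      change IsSignedTranslate R (maxFace (maxFace P (v + (s + ε) • u)) (-u)) at h5
      rw [h4, hε, hface] at h5
      exact hflip s h5
  obtain ⟨ε, hε, hε0⟩ := ((hP.eventually_maxFace_add_smul (-u) v).and
    self_mem_nhdsWithin).exists
  -- At s = -1/ε the functional is a positive multiple of -u + εv, which selects (P^{-u})^v.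
  have h5 : IsSignedTranslate R (maxFace (maxFace P (v + (-ε⁻¹) • u)) (-u)) := hall (-ε⁻¹)
  have h4 : v + (-ε⁻¹) • u = ε⁻¹ • (-u + ε • v) := by
    rw [smul_add, smul_smul, inv_mul_cancel₀ hε0.ne', one_smul]
    module
  rw [h4, maxFace_smul _ _ (inv_pos.2 hε0), hε] at h5
  rwa [maxFace_eq_self (f := -u)] at h5
  exact fun x hx y hy => apply_eq_of_mem_maxFace hx.1 hy.1

end Belt

/-! ### Opposite facets and the symmetry of the polytope -/

section Symmetry

variable {E : Type*} [NormedAddCommGroup E] [NormedSpace ℝ E] [FiniteDimensional ℝ E]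

/-- Given a facet normal v, take a nonzero x in ker v and a facet cone containing the ray of x. Its
normal w has w x > 0, so the hyperplanes ker v and ker w differ and together span. -/
theorem IsPolytope.exists_facets_sup_eq_top {A : Set E} (hA : IsPolytope A)
    (hA' : vectorSpan ℝ A = ⊤) (hdim : 2 ≤ Module.finrank ℝ E) :
    ∃ v w, IsFacetFunctional A v ∧ IsFacetFunctional A w ∧
      vectorSpan ℝ (maxFace A v) ⊔ vectorSpan ℝ (maxFace A w) = ⊤ := by
  have : Nontrivial E := Module.nontrivial_of_finrank_pos (R := ℝ) (by omega)
  obtain ⟨a, ha⟩ := hA.interior_nonempty hA'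
  have hA1 := hA.add_image (-a)
  have h0 := zero_mem_interior_add_image ha
  obtain ⟨v, hv, -⟩ := exists_facetNormal_gauge_le hA1 h0 0
  have hv0 := hA1.ne_zero_of_mem_facetNormals hv
  have hkv := Module.Dual.finrank_ker_add_one_of_ne_zero hv0
  obtain ⟨x, hx, hx0⟩ := Submodule.exists_mem_ne_zero_of_ne_bot (p := LinearMap.ker v) (by
    intro h
    rw [h, finrank_bot] at hkv
    omega)
  obtain ⟨w, hw, hwx⟩ := exists_facetNormal_gauge_le hA1 h0 x
  have hw0 := hA1.ne_zero_of_mem_facetNormals hw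
  have hkw := Module.Dual.finrank_ker_add_one_of_ne_zero hw0
  have hpos := gauge_pos_of_ne_zero hA1.isCompact h0 hx0
  have hlt : LinearMap.ker w < LinearMap.ker v ⊔ LinearMap.ker w := by
    refine lt_of_le_of_ne le_sup_right fun h => ?_
    have : x ∈ LinearMap.ker w := by rw [h]; exact Submodule.mem_sup_left hx
    rw [LinearMap.mem_ker] at this
    linarith
  have h1 := Submodule.finrank_lt_finrank_of_lt hlt
  have h2 := hv.1.ker_eq hv0
  have h3 := hw.1.ker_eq hw0
  have h4 := hv.1
  have h5 := hw.1
  unfold IsFacetFunctional at h4 h5 ⊢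
  rw [maxFace_add_image, vectorSpan_add_image] at h2 h3 h4 h5
  refine ⟨v, w, h4, h5, ?_⟩
  rw [h2, h3]
  refine Submodule.eq_top_of_finrank_eq (le_antisymm (Submodule.finrank_le _) (by omega))

/-- If the facets of `P` are point symmetric, the face opposite to a facet is parallel to it. -/
theorem IsPolytope.isFacetFunctional_neg {P : Set E} (hP : IsPolytope P)
    (hdim : 3 ≤ Module.finrank ℝ E)
    (hsym : ∀ f : Module.Dual ℝ E, IsFacetFunctional P f → IsPointSymmetric (maxFace P f))
    {u : Module.Dual ℝ E} (hu0 : u ≠ 0) (hu : IsFacetFunctional P u) :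
    IsFacetFunctional P (-u) := by
  have hk := Module.Dual.finrank_ker_add_one_of_ne_zero hu0
  obtain ⟨p, hp⟩ := (hP.face u).nonempty
  have hW : ∀ x ∈ maxFace P u, x - p ∈ LinearMap.ker u := fun x hx => by
    simp [apply_eq_of_mem_maxFace hx hp]
  have hfin := finrank_vectorSpan_submoduleChart hW
  have hu' := hu
  unfold IsFacetFunctional at hu'
  obtain ⟨g, g', hg, hg', hsup⟩ := ((hP.face u).chart hW).exists_facets_sup_eq_top
    (Submodule.eq_top_of_finrank_eq (by omega)) (by omega)
  -- Each facet of P^u has a copy inside P^{-u}, so P^{-u} contains its directions; two non-parallel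
  -- facets of P^u already span ker u.
  have key : ∀ g, IsFacetFunctional (submoduleChart (LinearMap.ker u) p (maxFace P u)) g →
      (vectorSpan ℝ (maxFace (submoduleChart (LinearMap.ker u) p (maxFace P u)) g)).map
        (LinearMap.ker u).subtype ≤ vectorSpan ℝ (maxFace P (-u)) := by
    intro g hg
    obtain ⟨f, rfl⟩ := exists_extend_dual g
    have hW' : ∀ x ∈ maxFace (maxFace P u) f, x - p ∈ LinearMap.ker u := fun x hx => hW x hx.1
    unfold IsFacetFunctional at hg
    rw [maxFace_submoduleChart hW] at hg ⊢
    rw [finrank_vectorSpan_submoduleChart hW'] at hg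
    rw [map_vectorSpan_submoduleChart hW',
      ← (hP.isSignedTranslate_maxFace_neg hsym hu' (v := f) (by omega)).vectorSpan_eq]
    exact vectorSpan_mono ℝ (maxFace_subset _ _)
  have hle : LinearMap.ker u ≤ vectorSpan ℝ (maxFace P (-u)) := by
    have h1 := sup_le (key g hg) (key g' hg')
    rwa [← Submodule.map_sup, hsup, Submodule.map_subtype_top] at h1
  have h2 := vectorSpan_maxFace_le_ker P (-u)
  have h3 : LinearMap.ker (-u) = LinearMap.ker u := by ext x; simp
  rw [h3] at h2
  unfold IsFacetFunctional
  rw [le_antisymm h2 hle, hk]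

/-- If the facets of `P` are point symmetric, opposite facets are translates of each other. -/
theorem IsPolytope.isSignedTranslate_opposite_facet {P : Set E} (hP : IsPolytope P)
    (hdim : 3 ≤ Module.finrank ℝ E)
    (hsym : ∀ f : Module.Dual ℝ E, IsFacetFunctional P f → IsPointSymmetric (maxFace P f))
    {u : Module.Dual ℝ E} (hu0 : u ≠ 0) (hu : IsFacetFunctional P u) :
    IsSignedTranslate (maxFace P u) (maxFace P (-u)) := by
  have hk := Module.Dual.finrank_ker_add_one_of_ne_zero hu0
  have hnu := hP.isFacetFunctional_neg hdim hsym hu0 hu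
  obtain ⟨p, hp⟩ := (hP.face u).nonempty
  obtain ⟨q, hq⟩ := (hP.face (-u)).nonempty
  have hW : ∀ x ∈ maxFace P u, x - p ∈ LinearMap.ker u := fun x hx => by
    simp [apply_eq_of_mem_maxFace hx hp]
  have hW' : ∀ x ∈ maxFace P (-u), x - q ∈ LinearMap.ker u := fun x hx => by
    have := apply_eq_of_mem_maxFace hx hq
    simp only [LinearMap.neg_apply, neg_inj] at this
    simp [this]
  have hfin := finrank_vectorSpan_submoduleChart hW
  have hfin' := finrank_vectorSpan_submoduleChart hW'
  have hu' := hu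
  have hnu' := hnu
  unfold IsFacetFunctional at hu' hnu'
  -- Uniqueness inside ker u, whose dimension is at least 2. Facets of P^{-u} are matched by the
  -- belt argument started from -u.
  obtain ⟨z, hz⟩ := exists_translate_of_isSignedTranslate ((hP.face u).chart hW)
    ((hP.face (-u)).chart hW') (Submodule.eq_top_of_finrank_eq (by omega))
    (Submodule.eq_top_of_finrank_eq (by omega)) (by omega) (by
      intro g hg
      obtain ⟨f, rfl⟩ := exists_extend_dual g
      have hWf : ∀ x ∈ maxFace (maxFace P u) f, x - p ∈ LinearMap.ker u := fun x hx => hW x hx.1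
      have hWf' : ∀ x ∈ maxFace (maxFace P (-u)) f, x - q ∈ LinearMap.ker u :=
        fun x hx => hW' x hx.1
      unfold IsFacetFunctional at hg
      rw [maxFace_submoduleChart hW, maxFace_submoduleChart hW'] at hg ⊢
      rw [finrank_vectorSpan_submoduleChart hWf, finrank_vectorSpan_submoduleChart hWf'] at hg
      refine IsSignedTranslate.chart ((hP.face u).face f).nonempty hWf hWf' ?_
      rcases hg with hg | hg
      · exact hP.isSignedTranslate_maxFace_neg hsym hu' (by omega)
      · have := hP.isSignedTranslate_maxFace_neg hsym hnu' (v := f) (by omega)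
        rw [neg_neg] at this
        exact this.symm)
  refine IsSignedTranslate.symm ⟨p + z - q, Or.inl ?_⟩
  rw [← image_submoduleChart hW, hz, image_image]
  conv_rhs => rw [← image_submoduleChart hW', image_image]
  refine image_congr fun x _ => ?_
  simp only [Submodule.coe_add]
  abel

/-- A full-dimensional polytope of dimension at least three with point symmetric facets is point
symmetric. -/
theorem IsPolytope.isPointSymmetric {P : Set E} (hP : IsPolytope P) (hP' : vectorSpan ℝ P = ⊤)
    (hdim : 3 ≤ Module.finrank ℝ E)
    (hsym : ∀ f : Module.Dual ℝ E, IsFacetFunctional P f → IsPointSymmetric (maxFace P f)) :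
    IsPointSymmetric P := by
  have hne : ∀ f, IsFacetFunctional P f → f ≠ 0 := by
    rintro f hf rfl
    unfold IsFacetFunctional at hf
    rw [maxFace_eq_self (by simp), hP', finrank_top] at hf
    omega
  -- Compare P with -P: the face of -P in direction v is -P^{-v}, a signed translate of P^v.
  obtain ⟨z, hz⟩ := exists_translate_of_isSignedTranslate hP (hP.sub_image 0) hP'
    (by rw [vectorSpan_sub_image, hP']) (by omega) (by
      intro v hv
      rw [maxFace_sub_image]
      have hv' : IsFacetFunctional P v := by
        rcases hv with hv | hv
        · exact hv
        · unfold IsFacetFunctional at hv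
          rw [maxFace_sub_image, vectorSpan_sub_image] at hv
          have h1 : IsFacetFunctional P (-v) := hv
          simpa using hP.isFacetFunctional_neg hdim hsym (hne _ h1) h1
      exact (hP.isSignedTranslate_opposite_facet hdim hsym (hne v hv') hv').trans ⟨0, Or.inr rfl⟩)
  refine ⟨z, ?_⟩
  conv_lhs => rw [hz]
  rw [image_image]
  refine image_congr fun x _ => by abel

end Symmetry

/-! ### Translation to the definitions of the statement -/

section Euclidean

theorem isCentrallySymmetric_iff_isPointSymmetric {d : ℕ} {X : Set (EuclideanSpace ℝ (Fin d))} :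
    IsCentrallySymmetric X ↔ IsPointSymmetric X := by
  have h : ∀ c : EuclideanSpace ℝ (Fin d),
      symmetricImage c X = (fun x => (2 : ℝ) • c - x) '' X := fun c => by
    ext y
    simp only [symmetricImage, mem_ofPred_eq, mem_image, eq_comm]
  constructor
  · rintro ⟨c, hc⟩
    exact ⟨(2 : ℝ) • c, by rwa [h] at hc⟩
  · rintro ⟨t, ht⟩
    refine ⟨(2⁻¹ : ℝ) • t, ?_⟩
    rwa [h, smul_smul, mul_inv_cancel₀ two_ne_zero, one_smul]

end Euclidean

theorem proposition1p3 (d n : ℕ) (hn : 2 < n) (P : Set (EuclideanSpace ℝ (Fin d)))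
    (hP : IsConvexPolytope P) (hdim : affineDim P = n)
    (hfacets : ∀ F : Set (EuclideanSpace ℝ (Fin d)), IsFacet P F → IsCentrallySymmetric F) :
    IsCentrallySymmetric P := by
  have hP : IsPolytope P := hP
  obtain ⟨p, hp⟩ := hP.nonempty
  have hW : ∀ x ∈ P, x - p ∈ vectorSpan ℝ P := fun x hx => vsub_mem_vectorSpan ℝ hx hp
  have hfin := finrank_vectorSpan_submoduleChart hW
  have hdim' : Module.finrank ℝ (vectorSpan ℝ P) = n := hdim
  refine isCentrallySymmetric_iff_isPointSymmetric.2 (.of_submoduleChart hW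
    ((hP.chart hW).isPointSymmetric (Submodule.eq_top_of_finrank_eq hfin) (by omega) ?_))
  intro g hg
  obtain ⟨f, rfl⟩ := exists_extend_dual g
  have hWf : ∀ x ∈ maxFace P f, x - p ∈ vectorSpan ℝ P := fun x hx => hW x hx.1
  unfold IsFacetFunctional at hg
  rw [maxFace_submoduleChart hW] at hg ⊢
  rw [finrank_vectorSpan_submoduleChart hWf] at hg
  have hF : IsFacet P (maxFace P f) :=
    ⟨(hP.face f).nonempty, fun _ => ⟨LinearMap.toContinuousLinearMap f, rfl⟩, hg⟩
  obtain ⟨s, hs⟩ := isCentrallySymmetric_iff_isPointSymmetric.1 (hfacets _ hF)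
  -- With both sets equal to the face, this transfers its point symmetry to the chart.
  exact submoduleChart_eq_sub_image (hP.face f).nonempty hWf hWf hs
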